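/- For $j\in\mathbb N$, a ($2j$-th order) NLS-like equation is an equation $$i\partial_t u+(-1)^{j+1}\partial_x^{2j}u=\sum_{k=1}^{j}\ \sum_{\alpha\in\mathbb N_0^{2k+1},\ |\alpha|=2(j-k)}c_{k,\alpha}\,\partial_x^{\alpha_1}u\prod_{\ell=1}^{k}\partial_x^{\alpha_{2\ell}}\overline u\;\partial_x^{\alpha_{2\ell+1}}u,\qquad x\in\mathbb R,\tag{1}$$ with coefficients $c_{k,\alpha}\in\mathbb Z$. For $s\in\mathbb R$ and $1<r<\infty$, with $\frac1r+\frac1{r'}=1$, let $\hat H^s_r(\mathbb R)$ be the space of tempered distributions $u$ whose Fourier transform $\hat u$ (normalised as $\hat u(\xi)=(2\pi)^{-1/2}\int u(x)e^{ix\xi}\,dx$) is a function with $\|u\|_{\hat H^s_r}=\|(1+\xi^2)^{s/2}\hat u\|_{L^{r'}}<\infty$. A Schwartz solution of (1) on $(-T,T)$ is a smooth solution on $(-T,T)\times\mathbb R$ whose time slices are Schwartz functions, with each Schwartz seminorm bounded locally uniformly in time. For $R,T>0$, a flow map of (1) on the ball of radius $R$ and on $(-T,T)$ is a map $S:\hat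 H^s_r(\mathbb R)\times(-T,T)\to\hat H^s_r(\mathbb R)$ with $S(u(0),t)=u(t)$ for $|t|<T$ and every Schwartz solution $u$ on $(-T,T)$ with $\|u(0)\|_{\hat H^s_r}\le R$; nothing else is required of $S$. **Theorem.** Let $j\ge2$, $1<r\le2$ and $-\frac1{r'}<s<\frac{j-1}{r'}$. There is an NLS-like equation (1) (i.e. a choice of integer coefficients $c_{k,\alpha}$) whose flow map on $\hat H^s_r(\mathbb R)$ is not uniformly continuous on bounded sets. Precisely, for all $R,T>0$ and every $t$ with $0<|t|<T$: 1. for every flow map $S$ of (1) on the ball of radius $R$ and on $(-T,T)$, the map $u_0\mapsto S(u_0,t)$ is not uniformly continuous (from $\hat H^s_r$ to $\hat H^s_r$) on $\{u_0:\|u_0\|_{\hat H^s_r}\le R\}$; 2. there is $\varepsilon>0$ such that for every $\delta>0$ there are Schwartz solutions $u,v$ of (1) on $(-T,T)$ with $\|u(0)\|_{\hat H^s_r},\|v(0)\|_{\hat H^s_r}\le R$, $\|u(0)-v(0)\|_{\hat H^s_r}\le\delta$ and $\|u(t)-v(t)\|_{\hat H^s_r}\ge\varepsilon$. -/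

import Mathlib

open scoped SchwartzMap ENNReal ContDiff

noncomputable section

namespace NLSHierarchy

/-- Coefficients `c_{k, α} ∈ ℤ`, with `α ∈ ℕ₀^{2k+1}`, of an NLS-like equation. Only the values with
`1 ≤ k ≤ j` and `|α| = 2 (j - k)` are used in the `j`-th order equation. -/
abbrev Coefficients : Type := (k : ℕ) → (Fin (2 * k + 1) → ℕ) → ℤ

/-- The nonlinearity of an NLS-like equation,
`F(u) = ∑_{k=1}^{j} ∑_{α ∈ ℕ₀^{2k+1}, |α| = 2(j-k)}
  c_{k,α} ∂^{α_1} u ∏_{ℓ=1}^{k} ∂^{α_{2ℓ}} ū ∂^{α_{2ℓ+1}} u`,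
evaluated at the point `x`. The entries of `α` are numbered from `0` here (so `α_i` is `α (i - 1)`),
and so is the product over `ℓ`. -/
def nonlinearity (j : ℕ) (c : Coefficients) (f : ℝ → ℂ) (x : ℝ) : ℂ :=
  ∑ k ∈ Finset.Icc 1 j, ∑ α ∈ Finset.Nat.antidiagonalTuple (2 * k + 1) (2 * (j - k)),
    (c k α : ℂ) * (iteratedDeriv (α 0) f x *
      ∏ l : Fin k,
        (iteratedDeriv (α ⟨2 * l.val + 1, by omega⟩) (fun y => (starRingEnd ℂ) (f y)) x *
          iteratedDeriv (α ⟨2 * l.val + 2, by omega⟩) f x))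

/-- `u` is a smooth solution of `i ∂_t u + (-1)^{j+1} ∂_x^{2j} u = F(u)` on `(-T, T) × ℝ`, whose time
slices are Schwartz functions, with Schwartz seminorms bounded locally uniformly in time. The values
`u t` with `|t| ≥ T` play no role. -/
structure IsSchwartzSolution (j : ℕ) (c : Coefficients) (T : ℝ) (u : ℝ → 𝓢(ℝ, ℂ)) : Prop where
  smooth : ContDiffOn ℝ ∞ (fun p : ℝ × ℝ => u p.1 p.2) (Set.Ioo (-T) T ×ˢ Set.univ)
  bounded : ∀ T' < T, ∀ k l : ℕ, ∃ C : ℝ, ∀ t : ℝ, |t| ≤ T' →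
    SchwartzMap.seminorm ℝ k l (u t) ≤ C
  equation : ∀ t ∈ Set.Ioo (-T) T, ∀ x : ℝ,
    Complex.I * deriv (fun τ => u τ x) t + (-1) ^ (j + 1) * iteratedDeriv (2 * j) (u t) x =
      nonlinearity j c (u t) x

/-- The Fourier transform `φ̂(ξ) = (2π)^{-1/2} ∫ φ(x) e^{i x ξ} dx` of a Schwartz function. -/
def fourier (φ : 𝓢(ℝ, ℂ)) (ξ : ℝ) : ℂ :=
  ((Real.sqrt (2 * Real.pi))⁻¹ : ℝ) * ∫ x : ℝ, φ x * Complex.exp (Complex.I * x * ξ)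

/-- The Fourier transform `û` of the tempered distribution `u`, defined by `⟨û, φ⟩ = ⟨u, φ̂⟩`, is
(integration against) the function `g`. -/
def HasFourierTransform (u : 𝓢'(ℝ, ℂ)) (g : ℝ → ℂ) : Prop :=
  ∀ φ ψ : 𝓢(ℝ, ℂ), (∀ ξ, ψ ξ = fourier φ ξ) →
    MeasureTheory.Integrable (fun ξ => φ ξ * g ξ) ∧ u ψ = ∫ ξ, φ ξ * g ξ

/-- The norm `‖u‖_{Ĥ^s_r} = ‖⟨ξ⟩^s û‖_{L^{r'}}`, `⟨ξ⟩ = (1 + ξ²)^{1/2}`, for `1 < r < ∞`, with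
`r' = r / (r - 1)`. It is `∞` when `û` is not a function. (The function `û` is unique up to a null
set, so that the infimum is over at most one value.) -/
def hatNorm (s r : ℝ) (u : 𝓢'(ℝ, ℂ)) : ℝ≥0∞ :=
  ⨅ (g : ℝ → ℂ) (_ : HasFourierTransform u g),
    MeasureTheory.eLpNorm (fun ξ : ℝ => (((1 + ξ ^ 2) ^ (s / 2) : ℝ) : ℂ) * g ξ)
      (ENNReal.ofReal r.conjExponent) MeasureTheory.volume

/-- The Fourier-Lebesgue space `Ĥ^s_r(ℝ)`. -/
def HatSpace (s r : ℝ) : Type := {u : 𝓢'(ℝ, ℂ) // hatNorm s r u < ⊤}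

/-- `S` is a flow map, on data in the ball of radius `R` of `Ĥ^s_r(ℝ)` and for times in `(-T, T)`, of
the Cauchy problem with coefficients `c`: it assigns to the data of every Schwartz solution that
solution. Nothing is required of `S` at rougher data, so every notion of generalised solution which
is consistent with Schwartz solutions is covered. -/
def IsFlowMap (j : ℕ) (c : Coefficients) (s r R T : ℝ)
    (S : HatSpace s r → ℝ → HatSpace s r) : Prop :=
  ∀ u : ℝ → 𝓢(ℝ, ℂ), IsSchwartzSolution j c T u →
    ∀ φ : HatSpace s r, φ.1 = (u 0 : 𝓢'(ℝ, ℂ)) → hatNorm s r φ.1 ≤ ENNReal.ofReal R →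
      ∀ t ∈ Set.Ioo (-T) T, (S φ t).1 = (u t : 𝓢'(ℝ, ℂ))

/-- `Φ` is uniformly continuous on the ball of radius `R` of `Ĥ^s_r(ℝ)`. -/
def IsUniformlyContinuousOnBall (s r R : ℝ) (Φ : HatSpace s r → HatSpace s r) : Prop :=
  ∀ ε : ℝ, 0 < ε → ∃ δ : ℝ, 0 < δ ∧ ∀ φ ψ : HatSpace s r,
    hatNorm s r φ.1 ≤ ENNReal.ofReal R → hatNorm s r ψ.1 ≤ ENNReal.ofReal R →
      hatNorm s r (φ.1 - ψ.1) ≤ ENNReal.ofReal δ →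
        hatNorm s r ((Φ φ).1 - (Φ ψ).1) ≤ ENNReal.ofReal ε

end NLSHierarchy

end

/-!
The equation is built so that it has the solitons of the focusing cubic NLS equation,
`u(t, x) = exp (i (N x + ω t)) φ (x - v t)` with `φ(x) = η sech (η x)`, for all `N ≠ 0` and `η > 0`.

*The equation.* Put `X = φ'/φ + i N`, `Y = φ'/φ - i N` and `P = φ²`. Then `u' = X u`, `ū' = Y ū`,
`u ū = P`, `X' = Y' = -P` and `P' = P (X + Y)`, so derivatives of `u` and `ū` are `u` and `ū` times
polynomials in the *jet ring* `ℤ[X, Y, P]`, where `X`, `Y` have weight `1` and `P` weight `2`. Since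
`X - Y = 2 i N` and `X Y + P = η² + N²` are constant, reducing `z ^ (2 j)` modulo
`z² = (X - Y) z + X Y + P` leaves a remainder `A + B z` with constant `A` and `B`, and
`A u + B u'` is absorbed by the frequency `ω` and the velocity `v`. The difference of `∂^{2j} u / u`
and `A + B X` is divisible by `P` (`jetSymbol_sub_remainder_mem`), and each weighted homogeneous
multiple of `P` is an integer combination of the nonlinear monomials of the equation
(`weightSpan_le_span_jetMonomial`): modulo `P ^ (k + 1)`, the monomial
`P ^ k X ^ a Y ^ b` is `∂^a u ∂^b ū u |u|^{2(k - 1)}` divided by `u`. This yields the coefficients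
`solitonCoefficients`, and `isSchwartzSolution_solitonSolution`.

*The instability.* Let `q = r'`. With `η = c N ^ (-s q)` the solitons have bounded norm as `N → ∞`,
because `û` is a bump of height `1` and width `η` around `-N`, and `-1/q < s` gives `η ≪ N`
(`exists_hatNorm_bound`). Two solitons with the same `N` and with `η`, `l η`, where `l` is close to
`1`, have data close to each other, uniformly in `N`. Their frequencies differ by about
`N ^ (2 j - 2) η² (l - 1)`, and `N ^ (2 j - 2) η² → ∞` because `s < (j - 1)/q`, so `l → 1` can be
chosen with phases that differ by exactly `π` at time `t`; the distance of their centres is then of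
order `1/N`, much less than their width `1/η` (`exists_resonant_pair`). Hence the two solutions have
opposite signs on the bulk of the bump, and their difference is bounded from below
(`fourier_soliton_sub_ge`, `exists_separating_solutions`).
-/

noncomputable section

namespace NLSHierarchy

/-! ### The jet ring of a soliton -/

section Jets

open MvPolynomial

/-- The jet ring `ℤ[X, Y, P]`. The variables `X 0`, `X 1`, `X 2` stand for the logarithmic
derivative of a soliton, that of its complex conjugate, and its squared modulus. -/
abbrev Jet : Type := MvPolynomial (Fin 3) ℤ

/-- The derivation of the jet ring which corresponds to `∂_x`. -/
def jetDeriv : Derivation ℤ Jet Jet :=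
  mkDerivation ℤ ![-X 2, -X 2, X 2 * (X 0 + X 1)]

@[simp] lemma jetDeriv_X0 : jetDeriv (X 0) = -X 2 := by simp [jetDeriv, mkDerivation_X]
@[simp] lemma jetDeriv_X1 : jetDeriv (X 1) = -X 2 := by simp [jetDeriv, mkDerivation_X]
@[simp] lemma jetDeriv_X2 : jetDeriv (X 2) = X 2 * (X 0 + X 1) := by
  simp [jetDeriv, mkDerivation_X]

/-- The operator `f ↦ D f + X v * f`: it is `∂_x` on `f u` divided by `u`, for `u` with logarithmic
derivative `X v`. -/
def twistedDeriv (v : Fin 3) : Jet →ₗ[ℤ] Jet :=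
  jetDeriv.toLinearMap + LinearMap.mulLeft ℤ (X v)

lemma twistedDeriv_apply (v : Fin 3) (f : Jet) : twistedDeriv v f = jetDeriv f + X v * f := rfl

/-- The quotient `∂_x^a u / u` as an element of the jet ring, where `X v` is the logarithmic
derivative of `u`; so `v = 0` belongs to a soliton and `v = 1` to its complex conjugate. -/
def jetSymbol (v : Fin 3) (a : ℕ) : Jet := (twistedDeriv v)^[a] 1

lemma jetSymbol_succ (v : Fin 3) (a : ℕ) :
    jetSymbol v (a + 1) = twistedDeriv v (jetSymbol v a) :=
  Function.iterate_succ_apply' _ _ _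

/-- The jets of weight `w` (where `X 0`, `X 1` have weight `1` and `X 2` has weight `2`) which are
divisible by `X 2 ^ k`. -/
def weightSpan (k w : ℕ) : Submodule ℤ Jet :=
  Submodule.span ℤ {f | ∃ a b i : ℕ, k ≤ i ∧ a + b + 2 * i = w ∧
    f = X 0 ^ a * X 1 ^ b * X 2 ^ i}

lemma monomial_mem_weightSpan {k w : ℕ} (a b i : ℕ) (hk : k ≤ i) (hw : a + b + 2 * i = w) :
    (X 0 ^ a * X 1 ^ b * X 2 ^ i : Jet) ∈ weightSpan k w :=
  Submodule.subset_span ⟨a, b, i, hk, hw, rfl⟩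

lemma mul_mem_weightSpan {k w k' w' : ℕ} {f g : Jet} (hf : f ∈ weightSpan k w)
    (hg : g ∈ weightSpan k' w') : f * g ∈ weightSpan (k + k') (w + w') := by
  have h : weightSpan k w * weightSpan k' w' ≤ weightSpan (k + k') (w + w') := by
    rw [weightSpan, weightSpan, Submodule.span_mul_span, Submodule.span_le]
    rintro _ ⟨_, ⟨a, b, i, hi, hw, rfl⟩, _, ⟨a', b', i', hi', hw', rfl⟩, rfl⟩
    have := monomial_mem_weightSpan (k := k + k') (w := w + w') (a + a') (b + b') (i + i')
      (by omega) (by omega)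
    have e : (X 0 ^ a * X 1 ^ b * X 2 ^ i : Jet) * (X 0 ^ a' * X 1 ^ b' * X 2 ^ i') =
        X 0 ^ (a + a') * X 1 ^ (b + b') * X 2 ^ (i + i') := by ring
    rw [← e] at this
    exact this
  exact h (Submodule.mul_mem_mul hf hg)

lemma weightSpan_mono {k k' : ℕ} (h : k ≤ k') (w : ℕ) : weightSpan k' w ≤ weightSpan k w := by
  refine Submodule.span_mono ?_
  rintro _ ⟨a, b, i, hi, hw, rfl⟩
  exact ⟨a, b, i, h.trans hi, hw, rfl⟩

lemma mem_weightSpan_of_le {k k' w w' : ℕ} {f : Jet} (h : f ∈ weightSpan k' w') (hk : k ≤ k')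
    (hw : w' = w) : f ∈ weightSpan k w :=
  hw ▸ weightSpan_mono hk w' h

lemma X0_mem : (X 0 : Jet) ∈ weightSpan 0 1 := by
  simpa using monomial_mem_weightSpan (k := 0) (w := 1) 1 0 0 le_rfl rfl

lemma X1_mem : (X 1 : Jet) ∈ weightSpan 0 1 := by
  simpa using monomial_mem_weightSpan (k := 0) (w := 1) 0 1 0 le_rfl rfl

lemma X2_mem : (X 2 : Jet) ∈ weightSpan 1 2 := by
  simpa using monomial_mem_weightSpan (k := 1) (w := 2) 0 0 1 le_rfl rfl

lemma one_mem_weightSpan : (1 : Jet) ∈ weightSpan 0 0 := by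
  simpa using monomial_mem_weightSpan (k := 0) (w := 0) 0 0 0 le_rfl rfl

lemma X_pow_mem {v : Fin 3} (hv : (X v : Jet) ∈ weightSpan 0 1) (a : ℕ) :
    (X v ^ a : Jet) ∈ weightSpan 0 a := by
  induction a with
  | zero => simpa using one_mem_weightSpan
  | succ a ih => 
    rw [pow_succ]
    exact mem_weightSpan_of_le (mul_mem_weightSpan ih hv) le_rfl rfl

lemma X2_pow_mem (i : ℕ) : (X 2 ^ i : Jet) ∈ weightSpan i (2 * i) := by
  simpa using monomial_mem_weightSpan (k := i) (w := 2 * i) 0 0 i le_rfl (by omega)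

lemma jetDeriv_X_pow_mem {v : Fin 3} (hv : (X v : Jet) ∈ weightSpan 0 1)
    (hD : jetDeriv (X v) = -X 2) (a : ℕ) :
    jetDeriv (X v ^ a) ∈ weightSpan 1 (a + 1) := by
  cases a with
  | zero => simp
  | succ a =>
    rw [Derivation.leibniz_pow, hD, Nat.add_sub_cancel, smul_eq_mul]
    refine Submodule.smul_of_tower_mem _ _ ?_
    have := mul_mem_weightSpan (X_pow_mem hv a) (Submodule.neg_mem _ X2_mem)
    simpa [add_assoc] using this

lemma jetDeriv_mem {k w : ℕ} {f : Jet} (hf : f ∈ weightSpan k w) :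
    jetDeriv f ∈ weightSpan k (w + 1) := by
  induction hf using Submodule.span_induction with
  | zero => simp
  | add f g _ _ hf hg => rw [map_add]; exact add_mem hf hg
  | smul c f _ hf => rw [Derivation.map_smul]; exact Submodule.smul_mem _ _ hf
  | mem f hf =>
    obtain ⟨a, b, i, hi, hw, rfl⟩ := hf
    have h0 := jetDeriv_X_pow_mem X0_mem jetDeriv_X0 a
    have h1 := jetDeriv_X_pow_mem X1_mem jetDeriv_X1 b
    have p0 := X_pow_mem X0_mem a
    have p1 := X_pow_mem X1_mem b
    have p2 := X2_pow_mem i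
    have h2 : jetDeriv (X 2 ^ i) ∈ weightSpan i (2 * i + 1) := by
      cases i with
      | zero => simp
      | succ i =>
        rw [Derivation.leibniz_pow, jetDeriv_X2, Nat.add_sub_cancel, smul_eq_mul]
        refine Submodule.smul_of_tower_mem _ _ ?_
        have := mul_mem_weightSpan p2 (add_mem X0_mem X1_mem)
        rw [pow_succ, mul_assoc] at this
        exact mem_weightSpan_of_le this (by omega) (by omega)
    rw [Derivation.leibniz, Derivation.leibniz]
    simp only [smul_eq_mul]
    have e1 := mul_mem_weightSpan (mul_mem_weightSpan p0 p1) h2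
    have e2 := mul_mem_weightSpan p2 (mul_mem_weightSpan p0 h1)
    have e3 := mul_mem_weightSpan p2 (mul_mem_weightSpan p1 h0)
    rw [mul_add]
    exact add_mem (mem_weightSpan_of_le e1 (by omega) (by omega))
      (add_mem (mem_weightSpan_of_le e2 (by omega) (by omega))
        (mem_weightSpan_of_le e3 (by omega) (by omega)))

lemma twistedDeriv_mem {v : Fin 3} (hv : (X v : Jet) ∈ weightSpan 0 1) {k w : ℕ} {f : Jet}
    (hf : f ∈ weightSpan k w) : twistedDeriv v f ∈ weightSpan k (w + 1) := by
  rw [twistedDeriv_apply, mul_comm]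
  exact add_mem (jetDeriv_mem hf) (mem_weightSpan_of_le (mul_mem_weightSpan hf hv) le_rfl rfl)

/-- To leading order in `X 2`, `∂_x^a u / u` is the `a`-th power of the logarithmic derivative. -/
lemma jetSymbol_sub_pow_mem {v : Fin 3} (hv : (X v : Jet) ∈ weightSpan 0 1)
    (hD : jetDeriv (X v) = -X 2) (a : ℕ) : jetSymbol v a - X v ^ a ∈ weightSpan 1 a := by
  induction a with
  | zero => simp [jetSymbol]
  | succ a ih =>
    have : jetSymbol v (a + 1) - X v ^ (a + 1)
        = twistedDeriv v (jetSymbol v a - X v ^ a) + jetDeriv (X v ^ a) := by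
      rw [jetSymbol_succ, map_sub, twistedDeriv_apply v (X v ^ a)]; ring
    rw [this]
    exact add_mem (twistedDeriv_mem hv ih) (jetDeriv_X_pow_mem hv hD a)

lemma jetSymbol_mem {v : Fin 3} (hv : (X v : Jet) ∈ weightSpan 0 1)
    (hD : jetDeriv (X v) = -X 2) (a : ℕ) : jetSymbol v a ∈ weightSpan 0 a := by
  have := add_mem (weightSpan_mono zero_le_one _ (jetSymbol_sub_pow_mem hv hD a)) (X_pow_mem hv a)
  simpa using this

/-- The remainder `A + B z` of `z ^ a` on division by `z² - s z - c`, as the pair `(A, B)`. -/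
def remainder {R : Type*} [CommRing R] (s c : R) : ℕ → R × R
  | 0 => (1, 0)
  | a + 1 => (c * (remainder s c a).2, (remainder s c a).1 + s * (remainder s c a).2)

lemma map_remainder {R S : Type*} [CommRing R] [CommRing S] (φ : R →+* S) (s c : R) (a : ℕ) :
    remainder (φ s) (φ c) a = (φ (remainder s c a).1, φ (remainder s c a).2) := by
  induction a with
  | zero => simp [remainder]
  | succ a ih => simp [remainder, ih]

/-- The remainder of `z ^ a` on division by `z² - (X 0 - X 1) z - (X 0 * X 1 + X 2)`. On a soliton
the two coefficients are the constants `2 i N` and `η² + N²`, and the roots are `i N ± η`. -/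
abbrev jetRemainder (a : ℕ) : Jet × Jet := remainder (X 0 - X 1) (X 0 * X 1 + X 2) a

lemma jetDeriv_jetRemainder (a : ℕ) :
    jetDeriv (jetRemainder a).1 = 0 ∧ jetDeriv (jetRemainder a).2 = 0 := by
  induction a with
  | zero => simp [remainder]
  | succ a ih =>
    obtain ⟨h1, h2⟩ := ih
    have hc : jetDeriv (X 0 * X 1 + X 2) = 0 := by
      simp [Derivation.leibniz]; ring
    constructor
    · simp only [remainder, Derivation.leibniz, hc, h2, smul_zero, add_zero]
    · simp only [remainder, Derivation.leibniz, map_add, map_sub, h1, h2, jetDeriv_X0,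
        jetDeriv_X1, smul_zero, add_zero, sub_self]

lemma X2_mul_jetRemainder_mem (a : ℕ) :
    X 2 * (jetRemainder a).1 ∈ weightSpan 1 (a + 2) ∧
      X 2 * (jetRemainder a).2 ∈ weightSpan 1 (a + 1) := by
  induction a with
  | zero => simpa [remainder] using X2_mem
  | succ a ih =>
    obtain ⟨h1, h2⟩ := ih
    constructor
    · have hc : (X 0 * X 1 + X 2 : Jet) ∈ weightSpan 0 2 :=
        add_mem (mem_weightSpan_of_le (mul_mem_weightSpan X0_mem X1_mem) le_rfl rfl)
          (mem_weightSpan_of_le X2_mem zero_le_one rfl)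
      have e : X 2 * (jetRemainder (a + 1)).1
          = (X 0 * X 1 + X 2) * (X 2 * (jetRemainder a).2) := by
        simp only [remainder]; ring
      rw [e]
      exact mem_weightSpan_of_le (mul_mem_weightSpan hc h2) le_rfl (by omega)
    · have e : X 2 * (jetRemainder (a + 1)).2
          = X 2 * (jetRemainder a).1 + X 2 * (jetRemainder a).2 * (X 0 - X 1) := by
        simp only [remainder]; ring
      rw [e]
      exact add_mem h1
        (mem_weightSpan_of_le (mul_mem_weightSpan h2 (sub_mem X0_mem X1_mem)) le_rfl rfl)

/-- Up to a multiple of `X 2`, `∂_x^a u / u` is a combination of `1` and `X 0 = u' / u` with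
constant coefficients. -/
lemma jetSymbol_sub_remainder_mem (a : ℕ) :
    jetSymbol 0 a - (jetRemainder a).1 - (jetRemainder a).2 * X 0 ∈ weightSpan 1 a := by
  induction a with
  | zero => simp [jetSymbol, remainder]
  | succ a ih =>
    obtain ⟨h1, h2⟩ := jetDeriv_jetRemainder a
    have key : jetSymbol 0 (a + 1) - (jetRemainder (a + 1)).1 - (jetRemainder (a + 1)).2 * X 0
        = twistedDeriv 0 (jetSymbol 0 a - (jetRemainder a).1 - (jetRemainder a).2 * X 0)
          - (2 : ℤ) • (X 2 * (jetRemainder a).2) := by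
      rw [jetSymbol_succ, map_sub, map_sub, twistedDeriv_apply 0 (jetRemainder a).1,
        twistedDeriv_apply 0 ((jetRemainder a).2 * X 0), Derivation.leibniz, h1, h2]
      simp only [remainder, jetDeriv_X0, smul_eq_mul, zsmul_eq_mul]
      push_cast
      ring
    rw [key]
    exact sub_mem (twistedDeriv_mem X0_mem ih)
      (Submodule.smul_mem _ _ (X2_mul_jetRemainder_mem a).2)

/-- The monomial `∂^{α_1} u ∏ ∂^{α_{2ℓ}} ū ∂^{α_{2ℓ+1}} u` of an NLS-like equation, divided by `u`,
as an element of the jet ring. -/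
def jetMonomial (p : Σ k : ℕ, Fin (2 * k + 1) → ℕ) : Jet :=
  X 2 ^ p.1 * (jetSymbol 0 (p.2 0) * ∏ l : Fin p.1,
    (jetSymbol 1 (p.2 ⟨2 * l.val + 1, by omega⟩) * jetSymbol 0 (p.2 ⟨2 * l.val + 2, by omega⟩)))

/-- The indices `(k, α)` of the monomials in the `j`-th order equation. -/
def jetIndices (j : ℕ) : Finset (Σ k : ℕ, Fin (2 * k + 1) → ℕ) :=
  (Finset.Icc 1 j).sigma fun k => Finset.Nat.antidiagonalTuple (2 * k + 1) (2 * (j - k))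

lemma X2_pow_mul_jetSymbol_mul_mem {j k a b : ℕ} (hk : 1 ≤ k) (hab : a + b + 2 * k = 2 * j) :
    X 2 ^ k * (jetSymbol 0 a * jetSymbol 1 b) ∈
      Submodule.span ℤ (jetMonomial '' (jetIndices j : Set _)) := by
  -- the monomial with derivatives `a` on the first `u`, `b` on the first `ū`, and no others
  refine Submodule.subset_span
    ⟨⟨k, Pi.single 0 a + Pi.single ⟨1, by omega⟩ b⟩, ?_, ?_⟩
  · simp only [jetIndices, Finset.coe_sigma, Set.mem_sigma_iff, Finset.mem_coe, Finset.mem_Icc,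
      Finset.Nat.mem_antidiagonalTuple, Pi.add_apply, Finset.sum_add_distrib,
      Finset.sum_pi_single', Finset.mem_univ, if_true]
    omega
  · simp only [jetMonomial]
    rw [Finset.prod_eq_single (⟨0, by omega⟩ : Fin k)]
    · simp [Fin.ext_iff, jetSymbol]
    · intro l _ hl
      have hl' : l.val ≠ 0 := fun h => hl (Fin.ext h)
      simp [Fin.ext_iff, jetSymbol, hl']
    · simp

/-- Every jet of weight `2 j` divisible by `X 2` comes from a nonlinearity with integer
coefficients. The induction is on the degree in `X 0`, `X 1`: replacing `X 0 ^ a * X 1 ^ b` by the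
jets of `∂^a u` and `∂^b ū` costs terms with a higher power of `X 2`. -/
theorem weightSpan_le_span_jetMonomial (j : ℕ) :
    weightSpan 1 (2 * j) ≤ Submodule.span ℤ (jetMonomial '' (jetIndices j : Set _)) := by
  suffices h : ∀ d a b i : ℕ, a + b = d → 1 ≤ i → a + b + 2 * i = 2 * j →
      (X 0 ^ a * X 1 ^ b * X 2 ^ i : Jet) ∈
        Submodule.span ℤ (jetMonomial '' (jetIndices j : Set _)) by
    refine Submodule.span_le.2 ?_
    rintro _ ⟨a, b, i, hi, hw, rfl⟩
    exact h _ a b i rfl hi hw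
  intro d
  induction d using Nat.strong_induction_on with
  | _ d ih =>
    intro a b i hd hi hw
    have hle : weightSpan (i + 1) (2 * j) ≤
        Submodule.span ℤ (jetMonomial '' (jetIndices j : Set _)) := by
      refine Submodule.span_le.2 ?_
      rintro _ ⟨a', b', i', hi', hw', rfl⟩
      exact ih (a' + b') (by omega) a' b' i' rfl (by omega) hw'
    have e0 := jetSymbol_sub_pow_mem X0_mem jetDeriv_X0 a
    have e1 := jetSymbol_sub_pow_mem X1_mem jetDeriv_X1 b
    have s0 := jetSymbol_mem X0_mem jetDeriv_X0 a
    have p1 := X_pow_mem X1_mem b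
    have p2 := X2_pow_mem i
    have h : X 2 ^ i * (jetSymbol 0 a * (jetSymbol 1 b - X 1 ^ b)
        + X 1 ^ b * (jetSymbol 0 a - X 0 ^ a)) ∈ weightSpan (i + 1) (2 * j) := by
      have h1 := mul_mem_weightSpan s0 e1
      have h2 := mul_mem_weightSpan p1 e0
      rw [Nat.add_comm b a] at h2
      have := mul_mem_weightSpan p2 (add_mem h1 h2)
      exact mem_weightSpan_of_le this (by omega) (by omega)
    have := sub_mem (X2_pow_mul_jetSymbol_mul_mem hi hw) (hle h)
    convert this using 1
    ring

end Jets

/-! ### Solitons and their derivatives -/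

section Solitons

open MvPolynomial

lemma hasDerivAt_aeval_jet {Z : ℝ → Fin 3 → ℂ} (x : ℝ)
    (h0 : HasDerivAt (fun x => Z x 0) (-Z x 2) x) (h1 : HasDerivAt (fun x => Z x 1) (-Z x 2) x)
    (h2 : HasDerivAt (fun x => Z x 2) (Z x 2 * (Z x 0 + Z x 1)) x) (G : Jet) :
    HasDerivAt (fun x => aeval (Z x) G) (aeval (Z x) (jetDeriv G)) x := by
  induction G using MvPolynomial.induction_on with
  | C a =>
    have : jetDeriv (C a) = 0 := by simp [jetDeriv]
    simpa [this] using hasDerivAt_const x ((a : ℂ))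
  | add p q hp hq => 
    simp only [map_add]
    exact hp.add hq
  | mul_X p i hp =>
    have hi : HasDerivAt (fun x => Z x i) (aeval (Z x) (jetDeriv (X i))) x := by
      fin_cases i <;> simpa
    rw [Derivation.leibniz]
    simp only [map_mul, map_add, smul_eq_mul, aeval_X]
    exact (hp.mul hi).congr_deriv (by ring)

lemma iteratedDeriv_eq_jetSymbol {Z : ℝ → Fin 3 → ℂ}
    (h0 : ∀ x, HasDerivAt (fun x => Z x 0) (-Z x 2) x)
    (h1 : ∀ x, HasDerivAt (fun x => Z x 1) (-Z x 2) x)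
    (h2 : ∀ x, HasDerivAt (fun x => Z x 2) (Z x 2 * (Z x 0 + Z x 1)) x)
    {v : Fin 3} {f : ℝ → ℂ} (hf : ∀ x, HasDerivAt f (Z x v * f x) x) (a : ℕ) :
    iteratedDeriv a f = fun x => aeval (Z x) (jetSymbol v a) * f x := by
  induction a with
  | zero => simp [jetSymbol]
  | succ a ih =>
    rw [iteratedDeriv_succ, ih]
    funext x
    have := (hasDerivAt_aeval_jet x (h0 x) (h1 x) (h2 x) (jetSymbol v a)).mul (hf x)
    refine this.deriv.trans ?_
    rw [jetSymbol_succ, twistedDeriv_apply]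
    simp only [map_add, map_mul, aeval_X]
    ring

/-- The function `exp (i (N x + θ)) η sech (η (x - y))`. -/
def solitonProfile (N η θ y x : ℝ) : ℂ :=
  Complex.exp (Complex.I * ((N * x + θ : ℝ) : ℂ)) * ((η / Real.cosh (η * (x - y)) : ℝ) : ℂ)

/-- The values at `x` of the three jet variables on `solitonProfile N η θ y`. -/
def solitonJet (N η y x : ℝ) : Fin 3 → ℂ :=
  ![Complex.I * N - ((η * Real.tanh (η * (x - y)) : ℝ) : ℂ),
    -(Complex.I * N) - ((η * Real.tanh (η * (x - y)) : ℝ) : ℂ),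
    (((η / Real.cosh (η * (x - y))) ^ 2 : ℝ) : ℂ)]

/-- The derivative of the profile `η sech (η (x - y))`, as a multiple of the profile. -/
lemma hasDerivAt_sech (η y x : ℝ) :
    HasDerivAt (fun x => η / Real.cosh (η * (x - y)))
      (-(η * Real.tanh (η * (x - y))) * (η / Real.cosh (η * (x - y)))) x := by
  have hc := (Real.cosh_pos (η * (x - y))).ne'
  have h := ((((hasDerivAt_id x).sub_const y).const_mul η).cosh.inv hc).const_mul η
  refine h.congr_deriv ?_
  simp only [id, Real.tanh_eq_sinh_div_cosh]
  field_simp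

lemma hasDerivAt_tanh (η y x : ℝ) :
    HasDerivAt (fun x => η * Real.tanh (η * (x - y)))
      ((η / Real.cosh (η * (x - y))) ^ 2) x := by
  have hc := (Real.cosh_pos (η * (x - y))).ne'
  have h0 := ((hasDerivAt_id x).sub_const y).const_mul η
  have h := (h0.sinh.div h0.cosh hc).const_mul η
  simp only [Real.tanh_eq_sinh_div_cosh]
  refine h.congr_deriv ?_
  simp only [id]
  field_simp
  linear_combination (η ^ 2) * Real.cosh_sq (η * (x - y))

lemma hasDerivAt_solitonJet (N η y x : ℝ) :
    HasDerivAt (fun x => solitonJet N η y x 0) (-solitonJet N η y x 2) x ∧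
    HasDerivAt (fun x => solitonJet N η y x 1) (-solitonJet N η y x 2) x ∧
    HasDerivAt (fun x => solitonJet N η y x 2)
      (solitonJet N η y x 2 * (solitonJet N η y x 0 + solitonJet N η y x 1)) x := by
  have ht := (hasDerivAt_tanh η y x).ofReal_comp
  have hs := ((hasDerivAt_sech η y x).pow 2).ofReal_comp
  refine ⟨ht.const_sub _, ht.const_sub _, ?_⟩
  refine hs.congr_deriv ?_
  simp only [solitonJet, Matrix.cons_val]
  push_cast
  ring

lemma hasDerivAt_solitonProfile (N η θ y x : ℝ) :
    HasDerivAt (solitonProfile N η θ y) (solitonJet N η y x 0 * solitonProfile N η θ y x) x := by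
  have h1 : HasDerivAt (fun x : ℝ => Complex.exp (Complex.I * ((N * x + θ : ℝ) : ℂ)))
      (Complex.exp (Complex.I * ((N * x + θ : ℝ) : ℂ)) * (Complex.I * N)) x := by
    have : HasDerivAt (fun x : ℝ => N * x + θ) N x := by
      simpa using ((hasDerivAt_id x).const_mul N).add_const θ
    exact (this.ofReal_comp.const_mul Complex.I).cexp
  refine (h1.mul (hasDerivAt_sech η y x).ofReal_comp).congr_deriv ?_
  simp only [solitonJet, solitonProfile, Matrix.cons_val]
  push_cast
  ring

lemma hasDerivAt_conj_solitonProfile (N η θ y x : ℝ) :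
    HasDerivAt (fun x => (starRingEnd ℂ) (solitonProfile N η θ y x))
      (solitonJet N η y x 1 * (starRingEnd ℂ) (solitonProfile N η θ y x)) x := by
  have e : ∀ x, (starRingEnd ℂ) (solitonProfile N η θ y x)
      = solitonProfile (-N) η (-θ) y x := by
    intro x
    simp only [solitonProfile, map_mul, Complex.conj_ofReal, ← Complex.exp_conj, Complex.conj_I]
    congr 2
    push_cast
    ring
  simp only [e]
  refine (hasDerivAt_solitonProfile (-N) η (-θ) y x).congr_deriv ?_
  simp [solitonJet]

lemma iteratedDeriv_solitonProfile (N η θ y x : ℝ) (a : ℕ) :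
    iteratedDeriv a (solitonProfile N η θ y) x =
      aeval (solitonJet N η y x) (jetSymbol 0 a) * solitonProfile N η θ y x :=
  congrFun (iteratedDeriv_eq_jetSymbol (fun x => (hasDerivAt_solitonJet N η y x).1)
    (fun x => (hasDerivAt_solitonJet N η y x).2.1) (fun x => (hasDerivAt_solitonJet N η y x).2.2)
    (hasDerivAt_solitonProfile N η θ y) a) x

lemma iteratedDeriv_conj_solitonProfile (N η θ y x : ℝ) (a : ℕ) :
    iteratedDeriv a (fun x => (starRingEnd ℂ) (solitonProfile N η θ y x)) x =
      aeval (solitonJet N η y x) (jetSymbol 1 a) *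
        (starRingEnd ℂ) (solitonProfile N η θ y x) :=
  congrFun (iteratedDeriv_eq_jetSymbol (fun x => (hasDerivAt_solitonJet N η y x).1)
    (fun x => (hasDerivAt_solitonJet N η y x).2.1) (fun x => (hasDerivAt_solitonJet N η y x).2.2)
    (hasDerivAt_conj_solitonProfile N η θ y) a) x

lemma norm_solitonProfile (N η θ y x : ℝ) :
    ‖solitonProfile N η θ y x‖ = |η / Real.cosh (η * (x - y))| := by
  rw [solitonProfile, norm_mul, mul_comm Complex.I, Complex.norm_exp_ofReal_mul_I, one_mul,
    Complex.norm_real, Real.norm_eq_abs]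

lemma exists_bound_aeval_solitonJet (N η : ℝ) (G : Jet) :
    ∃ C, 0 ≤ C ∧ ∀ y x, ‖aeval (solitonJet N η y x) G‖ ≤ C := by
  induction G using MvPolynomial.induction_on with
  | C a => exact ⟨‖(a : ℂ)‖, norm_nonneg _, fun y x => by simp⟩
  | add p q hp hq =>
    obtain ⟨A, hA, hA'⟩ := hp
    obtain ⟨B, hB, hB'⟩ := hq
    refine ⟨A + B, by positivity, fun y x => ?_⟩
    rw [map_add]
    exact (norm_add_le _ _).trans (add_le_add (hA' y x) (hB' y x))
  | mul_X p i hp =>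
    obtain ⟨A, hA, hA'⟩ := hp
    refine ⟨A * (|N| + |η| + η ^ 2), by positivity, fun y x => ?_⟩
    rw [map_mul, norm_mul, aeval_X]
    refine mul_le_mul (hA' y x) ?_ (norm_nonneg _) hA
    have ht : |η * Real.tanh (η * (x - y))| ≤ |η| := by
      rw [abs_mul]
      exact mul_le_of_le_one_right (abs_nonneg _) (Real.abs_tanh_lt_one _).le
    have hs : |(η / Real.cosh (η * (x - y))) ^ 2| ≤ η ^ 2 := by
      rw [abs_of_nonneg (sq_nonneg _), div_pow]
      exact div_le_self (sq_nonneg _) (one_le_pow₀ (Real.one_le_cosh _))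
    fin_cases i
    · refine (norm_sub_le _ _).trans ?_
      rw [norm_mul, Complex.norm_I, Complex.norm_real, Complex.norm_real, Real.norm_eq_abs,
        Real.norm_eq_abs, one_mul]
      linarith [sq_nonneg η]
    · refine (norm_sub_le _ _).trans ?_
      rw [norm_neg, norm_mul, Complex.norm_I, Complex.norm_real, Complex.norm_real,
        Real.norm_eq_abs, Real.norm_eq_abs, one_mul]
      linarith [sq_nonneg η]
    · simp only [solitonJet, Fin.reduceFinMk, Matrix.cons_val, Complex.norm_real, Real.norm_eq_abs]
      linarith [abs_nonneg N, abs_nonneg η]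

lemma pow_mul_sech_le {η : ℝ} (hη : 0 < η) (k : ℕ) {y Y : ℝ} (hy : |y| ≤ Y) (x : ℝ) :
    |x| ^ k * |η / Real.cosh (η * (x - y))| ≤
      η * (2 * (k.factorial / η ^ k * Real.exp (η * Y))) := by
  have hc := Real.cosh_pos (η * (x - y))
  rw [abs_of_pos (div_pos hη hc)]
  have h1 : |x| ^ k ≤ k.factorial / η ^ k * Real.exp (η * |x|) := by
    have := Real.pow_div_factorial_le_exp (η * |x|) (by positivity) k
    rw [mul_pow] at this
    rw [div_mul_eq_mul_div, le_div_iff₀ (by positivity)]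
    rw [div_le_iff₀ (by positivity)] at this
    linarith
  have h2 : Real.exp (η * |x|) ≤ Real.exp (η * Y) * (2 * Real.cosh (η * (x - y))) := by
    have h3 : Real.exp (η * |x - y|) ≤ 2 * Real.cosh (η * (x - y)) := by
      rw [← Real.cosh_abs, abs_mul, abs_of_pos hη, Real.cosh_eq]
      linarith [Real.exp_pos (-(η * |x - y|))]
    have h4 : η * |x| ≤ η * Y + η * |x - y| := by
      rw [← mul_add]
      refine mul_le_mul_of_nonneg_left ?_ hη.le
      have := abs_add_le y (x - y)
      rw [add_sub_cancel] at this
      linarith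
    calc Real.exp (η * |x|) ≤ Real.exp (η * Y + η * |x - y|) := Real.exp_le_exp.2 h4
      _ = Real.exp (η * Y) * Real.exp (η * |x - y|) := Real.exp_add _ _
      _ ≤ _ := mul_le_mul_of_nonneg_left h3 (Real.exp_pos _).le
  have h5 : |x| ^ k ≤ k.factorial / η ^ k *
      (Real.exp (η * Y) * (2 * Real.cosh (η * (x - y)))) :=
    h1.trans (mul_le_mul_of_nonneg_left h2 (by positivity))
  rw [← mul_div_assoc, div_le_iff₀ hc]
  nlinarith

/-- The Schwartz seminorms of `solitonProfile` are bounded uniformly in the phase and for bounded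
centres. -/
lemma exists_decay_solitonProfile (N : ℝ) {η : ℝ} (hη : 0 < η) (Y : ℝ) (k l : ℕ) :
    ∃ C, 0 ≤ C ∧ ∀ θ y x, |y| ≤ Y →
      |x| ^ k * ‖iteratedDeriv l (solitonProfile N η θ y) x‖ ≤ C := by
  obtain ⟨A, hA, hA'⟩ := exists_bound_aeval_solitonJet N η (jetSymbol 0 l)
  refine ⟨A * (η * (2 * (k.factorial / η ^ k * Real.exp (η * Y)))), by positivity,
    fun θ y x hy => ?_⟩
  rw [iteratedDeriv_solitonProfile, norm_mul, norm_solitonProfile, mul_left_comm]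
  exact mul_le_mul (hA' y x) (pow_mul_sech_le hη k hy x) (by positivity) hA

lemma contDiff_soliton_family (N η a c : ℝ) :
    ContDiff ℝ ∞ (fun p : ℝ × ℝ => solitonProfile N η (a * p.1) (c * p.1) p.2) := by
  have h1 : ContDiff ℝ ∞ (fun p : ℝ × ℝ => N * p.2 + a * p.1) := by fun_prop
  have h2 : ContDiff ℝ ∞ (fun p : ℝ × ℝ => η * (p.2 - c * p.1)) := by fun_prop
  have h3 : ContDiff ℝ ∞ (fun p : ℝ × ℝ => η / Real.cosh (η * (p.2 - c * p.1))) :=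
    contDiff_const.div (Real.contDiff_cosh.comp h2) (fun p => (Real.cosh_pos _).ne')
  exact (contDiff_const.mul (Complex.ofRealCLM.contDiff.comp h1)).cexp.mul
    (Complex.ofRealCLM.contDiff.comp h3)

lemma contDiff_solitonProfile (N η θ y : ℝ) : ContDiff ℝ ∞ (solitonProfile N η θ y) := by
  have h := (contDiff_soliton_family N η θ y).comp
    ((contDiff_const (c := (1 : ℝ))).prodMk (contDiff_id (E := ℝ)))
  simpa [Function.comp_def] using h

/-- `solitonProfile` as a Schwartz function. -/
def soliton (N : ℝ) {η : ℝ} (hη : 0 < η) (θ y : ℝ) : 𝓢(ℝ, ℂ) where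
  toFun := solitonProfile N η θ y
  smooth' := contDiff_solitonProfile N η θ y
  decay' k l := by
    obtain ⟨C, -, hC⟩ := exists_decay_solitonProfile N hη |y| k l
    refine ⟨C, fun x => ?_⟩
    rw [norm_iteratedFDeriv_eq_norm_iteratedDeriv, Real.norm_eq_abs]
    exact hC θ y x le_rfl

@[simp] lemma soliton_apply (N : ℝ) {η : ℝ} (hη : 0 < η) (θ y x : ℝ) :
    soliton N hη θ y x = solitonProfile N η θ y x := rfl

/-- The pair `(f, g)` of polynomials in `y` with `(x + i) ^ (2 j) = f(x²) + i x g(x²)`. -/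
def dispersion : ℕ → ℝ → ℝ × ℝ
  | 0, _ => (1, 0)
  | j + 1, y => ((y - 1) * (dispersion j y).1 - 2 * y * (dispersion j y).2,
      (y - 1) * (dispersion j y).2 + 2 * (dispersion j y).1)

/-- With roots `i N ± η`, the remainder `A + B z` takes the value `(η + i N) ^ (2 j)` at `η + i N`,
and `(η + i N) ^ (2 j) = N ^ (2 j) (f(y) + i (η / N) g(y))` with `y = η² / N²`. -/
lemma remainder_eq_dispersion {N : ℝ} (hN : N ≠ 0) (η : ℝ) (j : ℕ) :
    remainder (2 * Complex.I * N) ((η : ℂ) ^ 2 + (N : ℂ) ^ 2) (2 * j) =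
      ((N : ℂ) ^ (2 * j) * ((dispersion j (η ^ 2 / N ^ 2)).1 + (dispersion j (η ^ 2 / N ^ 2)).2),
        Complex.I * ((N : ℂ) ^ (2 * j) / N) * (dispersion j (η ^ 2 / N ^ 2)).2) := by
  have hN' : (N : ℂ) ≠ 0 := by exact_mod_cast hN
  induction j with
  | zero => simp [remainder, dispersion]
  | succ j ih =>
    -- one step of `dispersion` is two steps of `remainder`
    have e : 2 * (j + 1) = 2 * j + 1 + 1 := by ring
    rw [e, remainder, remainder, ih]
    simp only [dispersion]
    have hI := Complex.I_sq
    ext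
    · push_cast
      field_simp
      ring_nf
      rw [hI]
      ring
    · push_cast
      field_simp
      ring_nf
      rw [hI]
      ring

/-! ### The equation with soliton solutions -/

/-- Integer coefficients for which the nonlinearity, on a soliton, equals `(-1) ^ (j + 1)` times
`∂^{2j} u - A u - B u'`. -/
lemma exists_solitonCoefficients (j : ℕ) : ∃ c : Coefficients,
    ∑ k ∈ Finset.Icc 1 j, ∑ α ∈ Finset.Nat.antidiagonalTuple (2 * k + 1) (2 * (j - k)),
      c k α • jetMonomial ⟨k, α⟩ = (-1) ^ (j + 1) *
        (jetSymbol 0 (2 * j) - (jetRemainder (2 * j)).1 - (jetRemainder (2 * j)).2 * X 0) := by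
  have h := weightSpan_le_span_jetMonomial j (jetSymbol_sub_remainder_mem (2 * j))
  obtain ⟨c, hc⟩ := (Submodule.mem_span_image_finset_iff_exists_fun' ℤ).1 h
  refine ⟨fun k α => (-1) ^ (j + 1) * c ⟨k, α⟩, ?_⟩
  rw [← hc, jetIndices, Finset.sum_sigma, Finset.mul_sum]
  refine Finset.sum_congr rfl fun k _ => ?_
  rw [Finset.mul_sum]
  refine Finset.sum_congr rfl fun α _ => ?_
  rw [zsmul_eq_mul, zsmul_eq_mul]
  push_cast
  ring

/-- Coefficients of an NLS-like equation of order `2 j` which has all solitons as solutions. -/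
def solitonCoefficients (j : ℕ) : Coefficients := (exists_solitonCoefficients j).choose

lemma solitonProfile_mul_conj (N η θ y x : ℝ) :
    (starRingEnd ℂ) (solitonProfile N η θ y x) * solitonProfile N η θ y x =
      solitonJet N η y x 2 := by
  rw [mul_comm, Complex.mul_conj, Complex.normSq_eq_norm_sq, norm_solitonProfile, sq_abs]
  rfl

lemma nonlinearity_solitonProfile (j : ℕ) (c : Coefficients) (N η θ y x : ℝ) :
    nonlinearity j c (solitonProfile N η θ y) x =
      aeval (solitonJet N η y x) (∑ k ∈ Finset.Icc 1 j,
        ∑ α ∈ Finset.Nat.antidiagonalTuple (2 * k + 1) (2 * (j - k)),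
          c k α • jetMonomial ⟨k, α⟩) * solitonProfile N η θ y x := by
  simp only [nonlinearity, map_sum, Finset.sum_mul]
  refine Finset.sum_congr rfl fun k _ => Finset.sum_congr rfl fun α _ => ?_
  simp only [iteratedDeriv_solitonProfile, iteratedDeriv_conj_solitonProfile, jetMonomial,
    map_intCast, map_mul, map_prod, map_pow, aeval_X, zsmul_eq_mul, Finset.prod_mul_distrib]
  simp only [Finset.prod_const, Finset.card_univ, Fintype.card_fin,
    ← solitonProfile_mul_conj N η θ y x, mul_pow]
  ring

lemma aeval_jetRemainder {N : ℝ} (hN : N ≠ 0) (η y x : ℝ) (j : ℕ) :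
    aeval (solitonJet N η y x)
        ((jetRemainder (2 * j)).1 + (jetRemainder (2 * j)).2 * X 0) =
      (((N ^ (2 * j) * (dispersion j (η ^ 2 / N ^ 2)).1 : ℝ)) : ℂ) -
        Complex.I * ((N ^ (2 * j) / N * (dispersion j (η ^ 2 / N ^ 2)).2 *
          (η * Real.tanh (η * (x - y))) : ℝ) : ℂ) := by
  have h := map_remainder (aeval (solitonJet N η y x) : Jet →ₐ[ℤ] ℂ).toRingHom
    (X 0 - X 1) (X 0 * X 1 + X 2) (2 * j)
  have hs : (aeval (solitonJet N η y x) : Jet →ₐ[ℤ] ℂ).toRingHom (X 0 - X 1) =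
      2 * Complex.I * N := by
    simp [solitonJet]
    ring
  have hc : (aeval (solitonJet N η y x) : Jet →ₐ[ℤ] ℂ).toRingHom (X 0 * X 1 + X 2) =
      (η : ℂ) ^ 2 + (N : ℂ) ^ 2 := by
    have hcosh := (Real.cosh_pos (η * (x - y))).ne'
    have e : (η * Real.tanh (η * (x - y))) ^ 2 + (η / Real.cosh (η * (x - y))) ^ 2 = η ^ 2 := by
      rw [Real.tanh_eq_sinh_div_cosh]
      field_simp
      linear_combination -(η ^ 2) * Real.cosh_sq (η * (x - y))
    have e' : ((η * Real.tanh (η * (x - y)) : ℝ) : ℂ) ^ 2 +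
        ((η / Real.cosh (η * (x - y)) : ℝ) : ℂ) ^ 2 = (η : ℂ) ^ 2 := by exact_mod_cast e
    simp only [AlgHom.toRingHom_eq_coe, RingHom.coe_coe, map_add, map_mul, aeval_X, solitonJet,
      Matrix.cons_val, Complex.ofReal_pow]
    linear_combination e' - (N : ℂ) ^ 2 * Complex.I_sq
  rw [hs, hc, remainder_eq_dispersion hN, Prod.mk.injEq] at h
  obtain ⟨h1, h2⟩ := h
  have hN' : (N : ℂ) ≠ 0 := by exact_mod_cast hN
  rw [map_add, map_mul, aeval_X]
  simp only [AlgHom.toRingHom_eq_coe, RingHom.coe_coe] at h1 h2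
  rw [← h1, ← h2]
  simp only [solitonJet, Matrix.cons_val]
  push_cast
  field_simp
  linear_combination ((dispersion j (η ^ 2 / N ^ 2)).2 : ℂ) * (N : ℂ) * Complex.I_sq

/-- The temporal frequency of the soliton with carrier frequency `N` and amplitude `η`. -/
def frequencyShift (j : ℕ) (N η : ℝ) : ℝ :=
  (-1) ^ (j + 1) * (N ^ (2 * j) * (dispersion j (η ^ 2 / N ^ 2)).1)

/-- The velocity of the envelope of the soliton with carrier frequency `N` and amplitude `η`. -/
def velocity (j : ℕ) (N η : ℝ) : ℝ :=
  (-1) ^ (j + 1) * (N ^ (2 * j) / N * (dispersion j (η ^ 2 / N ^ 2)).2)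

/-- The travelling soliton with carrier frequency `N` and amplitude `η`. -/
def solitonSolution (j : ℕ) (N : ℝ) {η : ℝ} (hη : 0 < η) (t : ℝ) : 𝓢(ℝ, ℂ) :=
  soliton N hη (frequencyShift j N η * t) (velocity j N η * t)

lemma deriv_soliton_time (N η a c t x : ℝ) :
    deriv (fun τ => solitonProfile N η (a * τ) (c * τ) x) t =
      (Complex.I * a + ((c * (η * Real.tanh (η * (x - c * t))) : ℝ) : ℂ)) *
        solitonProfile N η (a * t) (c * t) x := by
  have h1 : HasDerivAt (fun τ : ℝ => Complex.exp (Complex.I * ((N * x + a * τ : ℝ) : ℂ)))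
      (Complex.exp (Complex.I * ((N * x + a * t : ℝ) : ℂ)) * (Complex.I * a)) t := by
    have : HasDerivAt (fun τ : ℝ => N * x + a * τ) a t := by
      simpa using ((hasDerivAt_id t).const_mul a).const_add (N * x)
    exact (this.ofReal_comp.const_mul Complex.I).cexp
  have h2 : HasDerivAt (fun τ : ℝ => η / Real.cosh (η * (x - c * τ)))
      (c * (η * Real.tanh (η * (x - c * t))) * (η / Real.cosh (η * (x - c * t)))) t := by
    have h3 : HasDerivAt (fun τ : ℝ => x - c * τ) (-c) t := by
      simpa using ((hasDerivAt_id t).const_mul c).const_sub x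
    have h4 := hasDerivAt_sech η 0 (x - c * t)
    have := h4.comp t h3
    simp only [sub_zero, Function.comp_def] at this
    exact this.congr_deriv (by ring)
  refine (h1.mul h2.ofReal_comp).deriv.trans ?_
  simp only [solitonProfile]
  push_cast
  ring

theorem isSchwartzSolution_solitonSolution (j : ℕ) {N : ℝ} (hN : N ≠ 0) {η : ℝ} (hη : 0 < η)
    (T : ℝ) : IsSchwartzSolution j (solitonCoefficients j) T (solitonSolution j N hη) where
  smooth := (contDiff_soliton_family N η _ _).contDiffOn
  bounded T' _ k l := by
    obtain ⟨C, hC, hC'⟩ := exists_decay_solitonProfile N hη (|velocity j N η| * T') k l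
    refine ⟨C, fun t ht => SchwartzMap.seminorm_le_bound' ℝ k l _ hC fun x => ?_⟩
    refine hC' _ _ _ ?_
    rw [abs_mul]
    exact mul_le_mul_of_nonneg_left ht (abs_nonneg _)
  equation t _ x := by
    have hd := deriv_soliton_time N η (frequencyShift j N η) (velocity j N η) t x
    have hi := iteratedDeriv_solitonProfile N η (frequencyShift j N η * t) (velocity j N η * t) x
      (2 * j)
    have hn := nonlinearity_solitonProfile j (solitonCoefficients j) N η
      (frequencyShift j N η * t) (velocity j N η * t) x
    rw [solitonCoefficients, (exists_solitonCoefficients j).choose_spec, ← solitonCoefficients,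
      sub_sub, map_mul, map_sub, aeval_jetRemainder hN] at hn
    change Complex.I * deriv (fun τ => solitonProfile N η (frequencyShift j N η * τ)
      (velocity j N η * τ) x) t + (-1) ^ (j + 1) * iteratedDeriv (2 * j)
        (solitonProfile N η (frequencyShift j N η * t) (velocity j N η * t)) x =
      nonlinearity j (solitonCoefficients j)
        (solitonProfile N η (frequencyShift j N η * t) (velocity j N η * t)) x
    rw [hd, hi, hn]
    generalize solitonProfile N η (frequencyShift j N η * t) (velocity j N η * t) x = w
    simp only [frequencyShift, velocity, map_pow, map_neg, map_one]
    push_cast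
    linear_combination ((-1) ^ (j + 1) * (N : ℂ) ^ (2 * j) *
      ((dispersion j (η ^ 2 / N ^ 2)).1 : ℂ)) * w * Complex.I_sq

end Solitons

section Analysis

open MeasureTheory Filter Topology

/-! ### The Fourier transform and the norm on Schwartz functions -/

lemma exists_schwartzMap_eq_fourier (φ : 𝓢(ℝ, ℂ)) : ∃ ψ : 𝓢(ℝ, ℂ), ∀ ξ, ψ ξ = fourier φ ξ := by
  have hc : -(2 * Real.pi)⁻¹ ≠ 0 := by simp [Real.pi_ne_zero]
  let e : ℝ ≃L[ℝ] ℝ := ContinuousLinearEquiv.smulLeft (Units.mk0 _ hc)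
  refine ⟨((Real.sqrt (2 * Real.pi))⁻¹ : ℝ) •
    SchwartzMap.compCLMOfContinuousLinearEquiv ℂ e (FourierTransform.fourier φ), fun ξ => ?_⟩
  rw [smul_apply, SchwartzMap.compCLMOfContinuousLinearEquiv_apply,
    Function.comp_apply, SchwartzMap.fourier_coe, Real.fourier_real_eq_integral_exp_smul,
    Complex.real_smul, fourier]
  congr 2
  funext x
  rw [smul_eq_mul, mul_comm]
  congr 2
  have : e ξ = -(2 * Real.pi)⁻¹ * ξ := rfl
  rw [this]
  have hp : (Real.pi : ℂ) ≠ 0 := by exact_mod_cast Real.pi_ne_zero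
  push_cast
  field_simp

/-- The Fourier transform in the normalisation of `fourier` is self-adjoint. -/
lemma integral_fourier_mul_eq (φ ψ : 𝓢(ℝ, ℂ)) :
    ∫ ξ, fourier φ ξ * ψ ξ = ∫ x, φ x * fourier ψ x := by
  let L : ℝ →ₗ[ℝ] ℝ →ₗ[ℝ] ℝ := (-(2 * Real.pi)⁻¹) • LinearMap.mul ℝ ℝ
  have hL : Continuous fun p : ℝ × ℝ => L p.1 p.2 := by
    simp only [L, LinearMap.smul_apply, LinearMap.mul_apply', smul_eq_mul]
    fun_prop
  have hf : ∀ (χ : 𝓢(ℝ, ℂ)) (ξ : ℝ), fourier χ ξ = ((Real.sqrt (2 * Real.pi))⁻¹ : ℝ) *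
      VectorFourier.fourierIntegral Real.fourierChar volume L χ ξ := by
    intro χ ξ
    rw [fourier, VectorFourier.fourierIntegral]
    congr 2
    funext x
    rw [Circle.smul_def, Real.fourierChar_apply, smul_eq_mul, mul_comm]
    congr 2
    have hp : (Real.pi : ℂ) ≠ 0 := by exact_mod_cast Real.pi_ne_zero
    simp only [L, LinearMap.smul_apply, LinearMap.mul_apply', smul_eq_mul]
    push_cast
    field_simp
  -- `L` is the symmetric pairing for which `𝐞 (-L x ξ) = exp (i x ξ)`
  have hflip : L.flip = L := by
    ext
    simp [L]
  have h := VectorFourier.integral_fourierIntegral_smul_eq_flip (L := L) (μ := volume)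
    (ν := volume) Real.continuous_fourierChar hL φ.integrable ψ.integrable
  rw [hflip] at h
  simp only [smul_eq_mul] at h
  simp only [hf, mul_assoc]
  rw [integral_const_mul, h, ← integral_const_mul]
  congr 1
  funext x
  ring

lemma integrable_schwartz_mul (φ ψ : 𝓢(ℝ, ℂ)) : Integrable (fun x => φ x * ψ x) := by
  obtain ⟨C, hC⟩ : ∃ C, ∀ x, ‖ψ x‖ ≤ C := ⟨_, ψ.norm_le_seminorm ℝ⟩
  exact φ.integrable.mul_bdd (c := C) ψ.continuous.aestronglyMeasurable
    (Filter.Eventually.of_forall hC)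

lemma hasFourierTransform_coe (φ : 𝓢(ℝ, ℂ)) :
    HasFourierTransform (φ : 𝓢'(ℝ, ℂ)) (fourier φ) := by
  intro χ ψ hψ
  obtain ⟨φ', hφ'⟩ := exists_schwartzMap_eq_fourier φ
  refine ⟨?_, ?_⟩
  · simp only [← hφ']
    exact integrable_schwartz_mul χ φ'
  · rw [SchwartzMap.coe_apply, ← integral_fourier_mul_eq]
    simp only [hψ, smul_eq_mul]

/-- The function representing the Fourier transform of a distribution is unique up to null sets. -/
lemma HasFourierTransform.ae_eq {u : 𝓢'(ℝ, ℂ)} {g h : ℝ → ℂ} (hg : HasFourierTransform u g)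
    (hh : HasFourierTransform u h) : g =ᵐ[volume] h := by
  have hloc : ∀ {g : ℝ → ℂ}, HasFourierTransform u g → LocallyIntegrable g := by
    intro g hg x
    -- test functions equal to `1` near `x` give integrability near `x`
    let b : ContDiffBump x := ⟨1, 2, one_pos, one_lt_two⟩
    have hb₁ : HasCompactSupport (Complex.ofRealCLM ∘ b) := b.hasCompactSupport.comp_left rfl
    have hb₂ : ContDiff ℝ ∞ (Complex.ofRealCLM ∘ b) := Complex.ofRealCLM.contDiff.comp b.contDiff
    obtain ⟨ψ, hψ⟩ := exists_schwartzMap_eq_fourier (hb₁.toSchwartzMap hb₂)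
    refine ⟨Metric.closedBall x 1, Metric.closedBall_mem_nhds x one_pos, ?_⟩
    refine (hg _ ψ hψ).1.integrableOn.congr_fun (fun y hy => ?_) measurableSet_closedBall
    have : b y = 1 := b.one_of_mem_closedBall hy
    simp [this]
  refine ae_eq_of_integral_contDiff_smul_eq (hloc hg) (hloc hh) fun χ hχ hχ' => ?_
  have h₁ : HasCompactSupport (Complex.ofRealCLM ∘ χ) := hχ'.comp_left rfl
  have h₂ : ContDiff ℝ ∞ (Complex.ofRealCLM ∘ χ) := Complex.ofRealCLM.contDiff.comp hχ
  obtain ⟨ψ, hψ⟩ := exists_schwartzMap_eq_fourier (h₁.toSchwartzMap h₂)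
  have := (hg _ ψ hψ).2.symm.trans (hh _ ψ hψ).2
  simpa using this

/-- On Schwartz functions the infimum in the definition of `hatNorm` is the norm computed with the
classical Fourier transform. -/
lemma hatNorm_coe (s r : ℝ) (φ : 𝓢(ℝ, ℂ)) :
    hatNorm s r (φ : 𝓢'(ℝ, ℂ)) =
      eLpNorm (fun ξ : ℝ => (((1 + ξ ^ 2) ^ (s / 2) : ℝ) : ℂ) * fourier φ ξ)
        (ENNReal.ofReal r.conjExponent) volume := by
  refine le_antisymm (iInf₂_le _ (hasFourierTransform_coe φ)) (le_iInf₂ fun g hg => ?_)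
  refine (eLpNorm_congr_ae ?_).le
  filter_upwards [(hasFourierTransform_coe φ).ae_eq hg] with ξ hξ
  rw [hξ]

lemma hatNorm_coe_sub (s r : ℝ) (φ ψ : 𝓢(ℝ, ℂ)) :
    hatNorm s r ((φ : 𝓢'(ℝ, ℂ)) - (ψ : 𝓢'(ℝ, ℂ))) =
      eLpNorm (fun ξ : ℝ => (((1 + ξ ^ 2) ^ (s / 2) : ℝ) : ℂ) * (fourier φ ξ - fourier ψ ξ))
        (ENNReal.ofReal r.conjExponent) volume := by
  have hi : ∀ (χ : 𝓢(ℝ, ℂ)) (ξ : ℝ),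
      Integrable (fun x : ℝ => χ x * Complex.exp (Complex.I * x * ξ)) := by
    intro χ ξ
    refine χ.integrable.mul_bdd (c := 1) (by fun_prop) (Filter.Eventually.of_forall fun x => ?_)
    rw [show Complex.I * x * ξ = ((x * ξ : ℝ) : ℂ) * Complex.I by push_cast; ring,
      Complex.norm_exp_ofReal_mul_I]
  rw [← map_sub, hatNorm_coe]
  congr 1
  funext ξ
  rw [fourier, fourier, fourier, ← mul_sub, ← integral_sub (hi φ ξ) (hi ψ ξ)]
  simp only [sub_apply, sub_mul]

/-- The function `sech` as a Schwartz function. -/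
def sechSchwartz : 𝓢(ℝ, ℂ) := soliton 0 one_pos 0 0

lemma fourier_soliton (N : ℝ) {η : ℝ} (hη : 0 < η) (θ y ξ : ℝ) :
    fourier (soliton N hη θ y) ξ =
      Complex.exp (Complex.I * ((θ + (ξ + N) * y : ℝ) : ℂ)) *
        fourier sechSchwartz ((ξ + N) / η) := by
  have hη' : (η : ℂ) ≠ 0 := by exact_mod_cast hη.ne'
  simp only [fourier]
  rw [mul_left_comm]
  congr 1
  have key : ∀ x : ℝ, soliton N hη θ y x * Complex.exp (Complex.I * x * ξ) =
      Complex.exp (Complex.I * ((θ + (ξ + N) * y : ℝ) : ℂ)) * ((η : ℂ) *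
      (fun z : ℝ => sechSchwartz z * Complex.exp (Complex.I * z * (((ξ + N) / η : ℝ) : ℂ)))
        (η * (x - y))) := by
    intro x
    simp only [sechSchwartz, soliton_apply, solitonProfile, zero_mul, zero_add, one_mul, sub_zero,
      Complex.ofReal_zero, mul_zero, Complex.exp_zero]
    have e : Complex.exp (Complex.I * ((N * x + θ : ℝ) : ℂ)) * Complex.exp (Complex.I * x * ξ) =
        Complex.exp (Complex.I * ((θ + (ξ + N) * y : ℝ) : ℂ)) *
          Complex.exp (Complex.I * ((η * (x - y) : ℝ) : ℂ) * (((ξ + N) / η : ℝ) : ℂ)) := by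
      rw [← Complex.exp_add, ← Complex.exp_add]
      congr 1
      push_cast
      field_simp
      ring
    rw [mul_right_comm, e]
    push_cast
    ring
  have h := integral_sub_right_eq_self (μ := volume) (fun x : ℝ => (fun z : ℝ =>
    sechSchwartz z * Complex.exp (Complex.I * z * (((ξ + N) / η : ℝ) : ℂ))) (η * x)) y
  have h' := Measure.integral_comp_mul_left (fun z : ℝ =>
    sechSchwartz z * Complex.exp (Complex.I * z * (((ξ + N) / η : ℝ) : ℂ))) η
  simp only [key]
  rw [integral_const_mul, integral_const_mul, h, h', abs_of_pos (inv_pos.2 hη), Complex.real_smul,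
    Complex.ofReal_inv, mul_inv_cancel_left₀ hη']

/-! ### Decay, weights and `L^q` bounds -/

lemma schwartz_rapid_decay (φ : 𝓢(ℝ, ℂ)) (K : ℕ) :
    ∃ C, 0 ≤ C ∧ ∀ x, (1 + x ^ 2) ^ K * ‖φ x‖ ≤ C ∧ (1 + x ^ 2) ^ K * ‖deriv φ x‖ ≤ C := by
  have h : ∀ n ≤ 1, ∀ x, (1 + x ^ 2) ^ K * ‖iteratedDeriv n φ x‖ ≤
      2 ^ (2 * K) * (Finset.Iic (2 * K, 1)).sup
        (fun m => SchwartzMap.seminorm ℝ m.1 m.2) φ := by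
    intro n hn x
    have h1 := SchwartzMap.one_add_le_sup_seminorm_apply (𝕜 := ℝ) (m := (2 * K, 1)) le_rfl hn φ x
    rw [norm_iteratedFDeriv_eq_norm_iteratedDeriv, Real.norm_eq_abs] at h1
    refine le_trans (mul_le_mul_of_nonneg_right ?_ (norm_nonneg _)) h1
    rw [pow_mul]
    refine pow_le_pow_left₀ (by positivity) ?_ K
    nlinarith [abs_nonneg x, sq_abs x]
  refine ⟨2 ^ (2 * K) * (Finset.Iic (2 * K, 1)).sup
    (fun m => SchwartzMap.seminorm ℝ m.1 m.2) φ,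
    mul_nonneg (by positivity) (apply_nonneg _ _), fun x => ⟨?_, ?_⟩⟩
  · simpa using h 0 zero_le_one x
  · simpa using h 1 le_rfl x

/-- Schwartz functions depend in a Lipschitz way on dilations by a factor `l ∈ [1, 2]`, with a
rapidly decaying Lipschitz constant. -/
lemma schwartz_dilation_sub_le (φ : 𝓢(ℝ, ℂ)) (K : ℕ) :
    ∃ C, 0 ≤ C ∧ ∀ l : ℝ, 1 ≤ l → l ≤ 2 → ∀ x : ℝ,
      (1 + x ^ 2) ^ K * ‖φ x - φ (x / l)‖ ≤ C * (l - 1) := by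
  obtain ⟨C, hC, h⟩ := schwartz_rapid_decay φ (K + 1)
  refine ⟨4 ^ (K + 1) * C, by positivity, fun l hl hl' x => ?_⟩
  have hl0 : 0 < l := by linarith
  have hx1 : 0 < 1 + x ^ 2 := by positivity
  have key : ‖φ x - φ (x / l)‖ ≤ 4 ^ (K + 1) * C / (1 + x ^ 2) ^ (K + 1) * ‖x - x / l‖ := by
    refine (convex_uIcc (x / l) x).norm_image_sub_le_of_norm_deriv_le (𝕜 := ℝ)
      (fun z _ => φ.differentiableAt) (fun z hz => ?_) Set.left_mem_uIcc Set.right_mem_uIcc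
    -- points between `x / l` and `x` have modulus at least `|x| / 2`, as `l ≤ 2`
    have hz2 : x ^ 2 ≤ 4 * z ^ 2 := by
      have hxl : |x| / 2 ≤ |x / l| := by
        rw [abs_div, abs_of_pos hl0]
        exact div_le_div_of_nonneg_left (abs_nonneg x) hl0 hl'
      have : |x| / 2 ≤ |z| := by
        rcases le_total 0 x with h0 | h0
        · have h1 : x / l ≤ x := div_le_self h0 hl
          rw [Set.uIcc_of_le h1] at hz
          have h2 : 0 ≤ x / l := by positivity
          rw [abs_of_nonneg h2] at hxl
          exact hxl.trans (hz.1.trans (le_abs_self z))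
        · have h1 : x ≤ x / l := by
            rw [le_div_iff₀ hl0]
            nlinarith
          rw [Set.uIcc_of_ge h1] at hz
          have h2 : x / l ≤ 0 := div_nonpos_of_nonpos_of_nonneg h0 hl0.le
          rw [abs_of_nonpos h2] at hxl
          have := neg_abs_le z
          linarith [hz.2]
      have h3 : |x| ≤ |2 * z| := by
        rw [abs_mul, abs_two]
        linarith
      have := sq_le_sq.2 h3
      nlinarith
    rw [le_div_iff₀ (by positivity), mul_comm]
    calc (1 + x ^ 2) ^ (K + 1) * ‖deriv φ z‖ ≤ (4 * (1 + z ^ 2)) ^ (K + 1) * ‖deriv φ z‖ := by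
          refine mul_le_mul_of_nonneg_right (pow_le_pow_left₀ hx1.le ?_ _) (norm_nonneg _)
          linarith
      _ = 4 ^ (K + 1) * ((1 + z ^ 2) ^ (K + 1) * ‖deriv φ z‖) := by rw [mul_pow]; ring
      _ ≤ _ := mul_le_mul_of_nonneg_left (h z).2 (by positivity)
  have hd : ‖x - x / l‖ ≤ (1 + x ^ 2) * (l - 1) := by
    have e : x - x / l = x * ((l - 1) / l) := by field_simp
    rw [e, norm_mul, Real.norm_eq_abs, Real.norm_eq_abs,
      abs_of_nonneg (div_nonneg (by linarith) hl0.le)]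
    refine mul_le_mul ?_ (div_le_self (by linarith) hl) (div_nonneg (by linarith) hl0.le) hx1.le
    nlinarith [sq_abs x, sq_nonneg (|x| - 1)]
  calc (1 + x ^ 2) ^ K * ‖φ x - φ (x / l)‖
      ≤ (1 + x ^ 2) ^ K * (4 ^ (K + 1) * C / (1 + x ^ 2) ^ (K + 1) * ((1 + x ^ 2) * (l - 1))) :=
        mul_le_mul_of_nonneg_left (key.trans (mul_le_mul_of_nonneg_left hd (by positivity)))
          (by positivity)
    _ = 4 ^ (K + 1) * C * (l - 1) := by
        field_simp
        ring

lemma sechSchwartz_apply (x : ℝ) : sechSchwartz x = ((1 / Real.cosh x : ℝ) : ℂ) := by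
  simp [sechSchwartz, solitonProfile]

lemma fourier_sech_zero_ne_zero : fourier sechSchwartz 0 ≠ 0 := by
  have hi : Integrable (fun x : ℝ => 1 / Real.cosh x) := by
    refine (sechSchwartz.integrable (μ := volume)).re.congr
      (Filter.Eventually.of_forall fun x => ?_)
    simp only [sechSchwartz_apply]
    exact Complex.ofReal_re _
  have hpos : 0 < ∫ x : ℝ, 1 / Real.cosh x := by
    refine (integral_pos_iff_support_of_nonneg
      (fun x => (div_pos one_pos (Real.cosh_pos x)).le) hi).2 ?_
    have : Function.support (fun x : ℝ => 1 / Real.cosh x) = Set.univ :=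
      Function.support_eq_univ fun x => (div_pos one_pos (Real.cosh_pos x)).ne'
    rw [this]
    simp
  have e : (∫ x : ℝ, sechSchwartz x * Complex.exp (Complex.I * x * (0 : ℝ))) =
      ((∫ x : ℝ, 1 / Real.cosh x : ℝ) : ℂ) := by
    rw [← integral_complex_ofReal]
    congr 1
    funext x
    simp [sechSchwartz_apply]
  rw [fourier, e]
  refine mul_ne_zero ?_ (by exact_mod_cast hpos.ne')
  have : Real.sqrt (2 * Real.pi) ≠ 0 := (Real.sqrt_pos.2 (by positivity)).ne'
  exact_mod_cast inv_ne_zero this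

/-- The weight `⟨ξ⟩^s` at `ξ = η ζ - N`, where `η = c N ^ (-σ)` is small compared with `N`, is at
most `N ^ s` up to a power of `1 + ζ²`. For `s ≥ 0` this needs `η ≤ 1`; for `s < 0` the weight is
large only near `ζ = N / η`, where `1 + ζ²` is at least a positive power of `N`. -/
lemma weight_le (s σ : ℝ) (hσ : -1 < σ) (hs : 0 ≤ s → 0 ≤ σ) :
    ∃ (K : ℕ) (C : ℝ), 0 ≤ C ∧ ∀ c N : ℝ, 0 < c → c ≤ 1 → 1 ≤ N → ∀ ζ : ℝ,
      (1 + (c * N ^ (-σ) * ζ - N) ^ 2) ^ (s / 2) ≤ C * N ^ s * (1 + ζ ^ 2) ^ K := by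
  rcases le_or_gt 0 s with h0 | h0
  · obtain ⟨K, hK⟩ := exists_nat_ge (s / 2)
    refine ⟨K, 4 ^ (s / 2), by positivity, fun c N hc hc1 hN ζ => ?_⟩
    have hN0 : 0 < N := by linarith
    have hη : c * N ^ (-σ) ≤ 1 :=
      mul_le_one₀ hc1 (by positivity)
        (Real.rpow_le_one_of_one_le_of_nonpos hN (by linarith [hs h0]))
    have hη0 : 0 < c * N ^ (-σ) := by positivity
    set η := c * N ^ (-σ)
    have h1 : 1 + (η * ζ - N) ^ 2 ≤ 4 * N ^ 2 * (1 + ζ ^ 2) := by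
      have h2 : η ^ 2 * ζ ^ 2 ≤ ζ ^ 2 :=
        mul_le_of_le_one_left (sq_nonneg ζ) (pow_le_one₀ hη0.le hη)
      have h3 : 1 ≤ N ^ 2 := one_le_pow₀ hN
      have h4 : ζ ^ 2 ≤ N ^ 2 * ζ ^ 2 := le_mul_of_one_le_left (sq_nonneg ζ) h3
      nlinarith [sq_nonneg (η * ζ + N)]
    calc (1 + (η * ζ - N) ^ 2) ^ (s / 2) ≤ (4 * N ^ 2 * (1 + ζ ^ 2)) ^ (s / 2) :=
          Real.rpow_le_rpow (by positivity) h1 (by positivity)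
      _ = 4 ^ (s / 2) * N ^ s * (1 + ζ ^ 2) ^ (s / 2) := by
          rw [Real.mul_rpow (by positivity) (by positivity),
            Real.mul_rpow (by positivity) (by positivity), ← Real.rpow_natCast N 2,
            ← Real.rpow_mul hN0.le]
          congr 3
          push_cast
          ring
      _ ≤ _ := by
          refine mul_le_mul_of_nonneg_left ?_ (by positivity)
          rw [← Real.rpow_natCast (1 + ζ ^ 2) K]
          exact Real.rpow_le_rpow_of_exponent_le (le_add_of_nonneg_right (sq_nonneg ζ)) hK
  · obtain ⟨K, hK⟩ := exists_nat_ge (-s / (2 * (1 + σ)))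
    have hσ1 : 0 < 1 + σ := by linarith
    rw [div_le_iff₀ (by positivity)] at hK
    refine ⟨K, 2 ^ (-s) + 4 ^ K, by positivity, fun c N hc hc1 hN ζ => ?_⟩
    have hN0 : 0 < N := by linarith
    have hη0 : 0 < c * N ^ (-σ) := by positivity
    have hζ1 : 1 ≤ (1 + ζ ^ 2) ^ K := one_le_pow₀ (by nlinarith [sq_nonneg ζ])
    have hNs : 0 < N ^ s := by positivity
    rcases le_or_gt (|c * N ^ (-σ) * ζ|) (N / 2) with h1 | h1
    · have h2 : (N / 2) ^ 2 ≤ 1 + (c * N ^ (-σ) * ζ - N) ^ 2 := by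
        have := abs_le.1 h1
        nlinarith
      calc (1 + (c * N ^ (-σ) * ζ - N) ^ 2) ^ (s / 2) ≤ ((N / 2) ^ 2) ^ (s / 2) :=
            Real.rpow_le_rpow_of_nonpos (by positivity) h2 (by linarith)
        _ = 2 ^ (-s) * N ^ s := by
            rw [← Real.rpow_natCast (N / 2) 2, ← Real.rpow_mul (by positivity),
              Real.div_rpow hN0.le zero_le_two, Real.rpow_neg zero_le_two]
            push_cast
            rw [mul_div_cancel₀ s two_ne_zero]
            field_simp
        _ ≤ (2 ^ (-s) + 4 ^ K) * N ^ s * 1 := by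
            rw [mul_one]
            refine mul_le_mul_of_nonneg_right ?_ hNs.le
            linarith [pow_pos (show (0 : ℝ) < 4 by norm_num) K]
        _ ≤ _ := mul_le_mul_of_nonneg_left hζ1 (by positivity)
    · have h2 : N ^ (1 + σ) / 2 ≤ |ζ| := by
        rw [abs_mul, abs_of_pos hη0] at h1
        have h3 : c * N ^ (-σ) * |ζ| ≤ N ^ (-σ) * |ζ| :=
          mul_le_mul_of_nonneg_right (mul_le_of_le_one_left (by positivity) hc1) (abs_nonneg _)
        have h4 : N = N ^ (-σ) * N ^ (1 + σ) := by
          rw [← Real.rpow_add hN0]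
          simp
        have h5 : N ^ (-σ) * (N ^ (1 + σ) / 2) ≤ N ^ (-σ) * |ζ| := by
          rw [← mul_div_assoc, ← h4]
          linarith
        exact le_of_mul_le_mul_left h5 (by positivity)
      have h3 : 1 ≤ 4 ^ K * N ^ s * (1 + ζ ^ 2) ^ K := by
        have h4 : (N ^ (1 + σ) / 2) ^ 2 ≤ 1 + ζ ^ 2 := by
          have := pow_le_pow_left₀ (by positivity) h2 2
          rw [sq_abs] at this
          linarith
        have h5 : (N ^ (1 + σ)) ^ (2 * K) ≤ 4 ^ K * (1 + ζ ^ 2) ^ K := by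
          rw [← mul_pow, pow_mul]
          refine pow_le_pow_left₀ (by positivity) ?_ K
          nlinarith
        have h6 : 1 ≤ N ^ s * (N ^ (1 + σ)) ^ (2 * K) := by
          rw [← Real.rpow_natCast, ← Real.rpow_mul hN0.le, ← Real.rpow_add hN0]
          refine Real.one_le_rpow hN ?_
          push_cast
          linarith
        calc 1 ≤ N ^ s * (N ^ (1 + σ)) ^ (2 * K) := h6
          _ ≤ N ^ s * (4 ^ K * (1 + ζ ^ 2) ^ K) := mul_le_mul_of_nonneg_left h5 hNs.le
          _ = _ := by ring
      calc (1 + (c * N ^ (-σ) * ζ - N) ^ 2) ^ (s / 2) ≤ 1 :=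
            Real.rpow_le_one_of_one_le_of_nonpos (by nlinarith [sq_nonneg (c * N ^ (-σ) * ζ - N)])
              (by linarith)
        _ ≤ 4 ^ K * N ^ s * (1 + ζ ^ 2) ^ K := h3
        _ ≤ _ := by
            refine mul_le_mul_of_nonneg_right (mul_le_mul_of_nonneg_right ?_ hNs.le) (by positivity)
            linarith [Real.rpow_pos_of_pos (show (0 : ℝ) < 2 by norm_num) (-s)]

/-- The `L^q` norm of a function dominated by a bump of height `A` and width `η`. The constant is
not sharp: the `q`-th power of the bump is bounded by the bump. -/
lemma eLpNorm_le_of_bound {q A η N : ℝ} (hq : 1 ≤ q) (hA : 0 ≤ A) (hη : 0 < η) {f : ℝ → ℂ}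
    (hf : ∀ ξ, ‖f ξ‖ ≤ A * (1 + ((ξ + N) / η) ^ 2)⁻¹) :
    eLpNorm f (ENNReal.ofReal q) volume ≤ ENNReal.ofReal (A * (η * Real.pi) ^ (1 / q)) := by
  have hq0 : 0 < q := by linarith
  have hi : Integrable (fun ξ : ℝ => (1 + ((ξ + N) / η) ^ 2)⁻¹) :=
    (integrable_inv_one_add_sq.comp_div hη.ne').comp_add_right N
  have hI : ∫ ξ : ℝ, (1 + ((ξ + N) / η) ^ 2)⁻¹ = η * Real.pi := by
    rw [integral_add_right_eq_self (fun ξ : ℝ => (1 + (ξ / η) ^ 2)⁻¹) N,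
      Measure.integral_comp_div (fun ξ : ℝ => (1 + ξ ^ 2)⁻¹) η, integral_univ_inv_one_add_sq,
      abs_of_pos hη, smul_eq_mul]
  rw [eLpNorm_eq_lintegral_rpow_enorm_toReal (by simpa using hq0) ENNReal.ofReal_ne_top,
    ENNReal.toReal_ofReal hq0.le]
  have h1 : ∫⁻ ξ, ‖f ξ‖ₑ ^ q ≤ ENNReal.ofReal (A ^ q * (η * Real.pi)) := by
    rw [← hI, ← integral_const_mul, ofReal_integral_eq_lintegral_ofReal (hi.const_mul _)
      (Filter.Eventually.of_forall fun ξ => by positivity)]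
    refine lintegral_mono fun ξ => ?_
    rw [← ofReal_norm, ENNReal.ofReal_rpow_of_nonneg (norm_nonneg _) hq0.le]
    refine ENNReal.ofReal_le_ofReal ?_
    refine (Real.rpow_le_rpow (norm_nonneg _) (hf ξ) hq0.le).trans ?_
    rw [Real.mul_rpow hA (by positivity)]
    refine mul_le_mul_of_nonneg_left ?_ (by positivity)
    have h2 : (1 + ((ξ + N) / η) ^ 2)⁻¹ ≤ 1 :=
      inv_le_one_of_one_le₀ (by nlinarith [sq_nonneg ((ξ + N) / η)])
    simpa using Real.rpow_le_rpow_of_exponent_ge (by positivity) h2 hq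
  refine (ENNReal.rpow_le_rpow h1 (by positivity)).trans ?_
  rw [ENNReal.ofReal_rpow_of_nonneg (by positivity) (by positivity),
    Real.mul_rpow (by positivity) (by positivity), ← Real.rpow_mul hA, mul_one_div_cancel hq0.ne',
    Real.rpow_one]

lemma le_eLpNorm_of_bound {q a N η : ℝ} (hq : 0 < q) (ha : 0 ≤ a) (hη : 0 ≤ η) {f : ℝ → ℂ}
    (hf : ∀ ξ, |ξ + N| ≤ η → a ≤ ‖f ξ‖) :
    ENNReal.ofReal (a * (2 * η) ^ (1 / q)) ≤ eLpNorm f (ENNReal.ofReal q) volume := by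
  have h := eLpNorm_indicator_const (μ := volume) (s := Set.Icc (-N - η) (-N + η)) (c := a)
    measurableSet_Icc (p := ENNReal.ofReal q) (by simpa using hq) ENNReal.ofReal_ne_top
  rw [Real.volume_Icc, ENNReal.toReal_ofReal hq.le, show -N + η - (-N - η) = 2 * η by ring,
    ENNReal.ofReal_rpow_of_nonneg (by positivity) (by positivity), Real.enorm_of_nonneg ha,
    ← ENNReal.ofReal_mul ha] at h
  rw [← h]
  refine eLpNorm_mono fun ξ => ?_
  by_cases hξ : ξ ∈ Set.Icc (-N - η) (-N + η)
  · rw [Set.indicator_of_mem hξ, Real.norm_of_nonneg ha]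
    refine hf ξ (abs_le.2 ⟨?_, ?_⟩)
    · linarith [hξ.1]
    · linarith [hξ.2]
  · rw [Set.indicator_of_notMem hξ, norm_zero]
    exact norm_nonneg _

/-! ### The dispersion relation -/

lemma contDiff_dispersion (j : ℕ) :
    ContDiff ℝ 1 (fun y => (dispersion j y).1) ∧ ContDiff ℝ 1 (fun y => (dispersion j y).2) := by
  induction j with
  | zero => exact ⟨contDiff_const, contDiff_const⟩
  | succ j ih =>
    obtain ⟨h1, h2⟩ := ih
    simp only [dispersion]
    constructor <;> fun_prop

lemma dispersion_zero (j : ℕ) : dispersion j 0 = ((-1) ^ j, -(-1) ^ j * (2 * (j : ℝ))) := by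
  induction j with
  | zero => simp [dispersion]
  | succ j ih =>
    simp only [dispersion, ih]
    ext <;> push_cast <;> ring

lemma hasDerivAt_dispersion_zero (j : ℕ) :
    HasDerivAt (fun y => (dispersion j y).1) (-(-1) ^ j * (j * (2 * j - 1))) 0 := by
  induction j with
  | zero => simpa [dispersion] using hasDerivAt_const (0 : ℝ) (1 : ℝ)
  | succ j ih =>
    -- the derivative of the second component drops out, as it is multiplied by `y = 0`
    have hg : HasDerivAt (fun y => (dispersion j y).2) _ 0 :=
      ((contDiff_dispersion j).2.differentiable one_ne_zero 0).hasDerivAt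
    have h := (((hasDerivAt_id (0 : ℝ)).sub_const 1).mul ih).sub
      (((hasDerivAt_id (0 : ℝ)).const_mul 2).mul hg)
    refine h.congr_deriv ?_
    simp only [dispersion_zero, id]
    push_cast
    ring

/-- On an interval `[0, ρ]` the first component of the dispersion separates points linearly, since
its derivative at `0` is `± j (2 j - 1) ≠ 0`, and the second one is Lipschitz. -/
lemma exists_dispersion_bounds {j : ℕ} (hj : 1 ≤ j) :
    ∃ m L ρ : ℝ, 0 < m ∧ 0 ≤ L ∧ 0 < ρ ∧ ∀ y ∈ Set.Icc 0 ρ, ∀ z ∈ Set.Icc 0 ρ,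
      m * |y - z| ≤ |(dispersion j y).1 - (dispersion j z).1| ∧
        |(dispersion j y).2 - (dispersion j z).2| ≤ L * |y - z| := by
  set d : ℝ := -(-1) ^ j * (j * (2 * j - 1)) with hd
  have hd0 : 0 < |d| := by
    have : (1 : ℝ) ≤ j := by exact_mod_cast hj
    rw [hd, abs_mul, abs_neg, abs_pow, abs_neg, abs_one, one_pow, one_mul]
    exact abs_pos.2 (mul_ne_zero (by linarith) (by linarith))
  have hf : HasStrictDerivAt (fun y => (dispersion j y).1) d 0 :=
    (contDiff_dispersion j).1.contDiffAt.hasStrictDerivAt' (hasDerivAt_dispersion_zero j)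
      one_ne_zero
  obtain ⟨L, U, hU, hL⟩ := (contDiff_dispersion j).2.contDiffAt.exists_lipschitzOnWith (x := 0)
  have h1 := hf.hasStrictFDerivAt.isLittleO.def (half_pos hd0)
  obtain ⟨ρ, hρ, hball⟩ := Metric.eventually_nhds_iff.1
    (h1.and ((prod_mem_nhds hU hU : U ×ˢ U ∈ 𝓝 ((0 : ℝ), (0 : ℝ)))))
  refine ⟨|d| / 2, L, ρ / 2, by positivity, L.2, by positivity, fun y hy z hz => ?_⟩
  have hyz : dist (y, z) ((0 : ℝ), (0 : ℝ)) < ρ := by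
    rw [Prod.dist_eq, max_lt_iff, Real.dist_eq, Real.dist_eq]
    simp only [sub_zero]
    rw [abs_of_nonneg hy.1, abs_of_nonneg hz.1]
    exact ⟨by linarith [hy.2], by linarith [hz.2]⟩
  obtain ⟨ha, hb⟩ := hball hyz
  constructor
  · simp only [Real.norm_eq_abs, ContinuousLinearMap.toSpanSingleton_apply, smul_eq_mul] at ha
    have h2 := abs_sub_abs_le_abs_sub ((y - z) * d)
      ((dispersion j y).1 - (dispersion j z).1)
    rw [abs_sub_comm ((y - z) * d), abs_mul] at h2
    nlinarith
  · have := hL.dist_le_mul y hb.1 z hb.2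
    simpa [Real.dist_eq] using this

/-- Two amplitudes `η` and `l η`, with `l ∈ [1, 1 + d]`, for which the phases of the solitons differ
by `π` at time `t` while their centres are at most `e / η` apart. The amplitude is found by the
intermediate value theorem, for a large frequency `N`. -/
lemma exists_resonant_pair {j : ℕ} (hj : 1 ≤ j) {σ c d t e : ℝ} (hσ : -1 < σ)
    (hσ' : σ < (j : ℝ) - 1) (hc : 0 < c) (hd : 0 < d) (ht : 0 < |t|) (he : 0 < e) :
    ∃ N η l : ℝ, 1 ≤ N ∧ η = c * N ^ (-σ) ∧ 0 < η ∧ η ≤ N ∧ 1 ≤ l ∧ l ≤ 1 + d ∧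
      |frequencyShift j N (l * η) * t - frequencyShift j N η * t| = Real.pi ∧
      η * |velocity j N (l * η) * t - velocity j N η * t| ≤ e := by
  obtain ⟨m, L, ρ, hm, hL, hρ, hb⟩ := exists_dispersion_bounds hj
  -- `η / N → 0`
  have t1 : Tendsto (fun N : ℝ => c * N ^ (-σ) / N) atTop (𝓝 0) := by
    have h := (tendsto_rpow_neg_atTop (y := 1 + σ) (by linarith)).const_mul c
    rw [mul_zero] at h
    refine h.congr' ?_
    filter_upwards [eventually_gt_atTop 0] with N hN
    rw [show -(1 + σ) = -σ - 1 by ring, Real.rpow_sub_one hN.ne', mul_div_assoc]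
  -- `N ^ (2 j - 2) η² → ∞`
  have t2 : Tendsto (fun N : ℝ => N ^ (2 * j) * (c * N ^ (-σ) / N) ^ 2) atTop atTop := by
    have h := (tendsto_rpow_atTop (y := 2 * ((j : ℝ) - 1 - σ)) (by linarith)).const_mul_atTop
      (show 0 < c ^ 2 by positivity)
    refine h.congr' ?_
    filter_upwards [eventually_gt_atTop 0] with N hN
    rw [show 2 * ((j : ℝ) - 1 - σ) = ((2 * j : ℕ) : ℝ) + (-σ - 1) + (-σ - 1) by push_cast; ring,
      Real.rpow_add hN, Real.rpow_add hN, Real.rpow_natCast, Real.rpow_sub_one hN.ne']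
    ring
  have hρ' : 0 < min 1 (min (Real.sqrt ρ / (1 + d)) (e * m / (L * Real.pi + 1))) := by
    have := Real.pi_pos
    have := Real.sqrt_pos.2 hρ
    positivity
  obtain ⟨N, hN1, hN2, hN3⟩ := ((eventually_ge_atTop 1).and ((t1.eventually_le_const hρ').and
    (t2.eventually_ge_atTop (Real.pi / (m * (2 * d) * |t|))))).exists
  have hN0 : 0 < N := by linarith
  have hη0 : 0 < c * N ^ (-σ) := by positivity
  set η := c * N ^ (-σ) with hη
  set x := η / N with hx
  have hx0 : 0 < x := by positivity
  rw [le_min_iff, le_min_iff] at hN2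
  obtain ⟨hx1, hx2, hx3⟩ := hN2
  have hpi := Real.pi_pos
  have hy2 : (x * (1 + d)) ^ 2 ≤ ρ := by
    rw [le_div_iff₀ (by positivity)] at hx2
    calc (x * (1 + d)) ^ 2 ≤ Real.sqrt ρ ^ 2 := pow_le_pow_left₀ (by positivity) hx2 2
      _ = ρ := Real.sq_sqrt hρ.le
  have hy12 : x ^ 2 ≤ (x * (1 + d)) ^ 2 :=
    pow_le_pow_left₀ hx0.le (by nlinarith) 2
  -- the phase difference at time `t` of the amplitudes `η` and `N √y`
  set F : ℝ → ℝ := fun y => N ^ (2 * j) * |(dispersion j y).1 - (dispersion j (x ^ 2)).1| * |t|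
    with hF
  have hFc : ContinuousOn F (Set.Icc (x ^ 2) ((x * (1 + d)) ^ 2)) := by
    have := (contDiff_dispersion j).1.continuous
    exact Continuous.continuousOn (by fun_prop)
  have hF1 : F (x ^ 2) ≤ Real.pi := by simpa [hF] using hpi.le
  have hF2 : Real.pi ≤ F ((x * (1 + d)) ^ 2) := by
    have h1 := (hb _ ⟨by positivity, hy2⟩ _ ⟨by positivity, hy12.trans hy2⟩).1
    have h2 : x ^ 2 * (2 * d) ≤ |(x * (1 + d)) ^ 2 - x ^ 2| := by
      refine le_trans ?_ (le_abs_self _)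
      nlinarith [mul_nonneg (sq_nonneg x) (sq_nonneg d)]
    rw [div_le_iff₀ (by positivity)] at hN3
    calc Real.pi ≤ N ^ (2 * j) * x ^ 2 * (m * (2 * d) * |t|) := hN3
      _ = N ^ (2 * j) * (m * (x ^ 2 * (2 * d))) * |t| := by ring
      _ ≤ N ^ (2 * j) *
            |(dispersion j ((x * (1 + d)) ^ 2)).1 - (dispersion j (x ^ 2)).1| * |t| := by
          refine mul_le_mul_of_nonneg_right (mul_le_mul_of_nonneg_left ?_ (by positivity)) ht.le
          exact (mul_le_mul_of_nonneg_left h2 hm.le).trans h1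
  obtain ⟨y, hy, hyF⟩ := intermediate_value_Icc hy12 hFc ⟨hF1, hF2⟩
  have hy0 : 0 ≤ y := le_trans (by positivity) hy.1
  have hb' := hb y ⟨hy0, hy.2.trans hy2⟩ (x ^ 2) ⟨by positivity, hy12.trans hy2⟩
  have hsq : Real.sqrt y ^ 2 = y := Real.sq_sqrt hy0
  have e1 : η ^ 2 / N ^ 2 = x ^ 2 := by rw [hx, div_pow]
  have e2 : (Real.sqrt y / x * η) ^ 2 / N ^ 2 = y := by
    have : Real.sqrt y / x * η = Real.sqrt y * N := by
      rw [hx]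
      field_simp
    rw [this, mul_pow, hsq, mul_div_cancel_right₀ _ (pow_ne_zero 2 hN0.ne')]
  refine ⟨N, η, Real.sqrt y / x, hN1, rfl, hη0, ?_, ?_, ?_, ?_, ?_⟩
  · rw [hx, div_le_one hN0] at hx1
    exact hx1
  · rw [one_le_div hx0]
    exact Real.le_sqrt_of_sq_le hy.1
  · rw [div_le_iff₀ hx0, mul_comm]
    exact Real.sqrt_le_iff.2 ⟨by positivity, hy.2⟩
  · rw [frequencyShift, frequencyShift, e1, e2, ← sub_mul, ← mul_sub, ← mul_sub, abs_mul, abs_mul,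
      abs_mul, abs_pow, abs_neg, abs_one, one_pow, one_mul, abs_of_pos (pow_pos hN0 _)]
    exact hyF
  · rw [velocity, velocity, e1, e2, ← sub_mul, ← mul_sub, ← mul_sub, abs_mul, abs_mul,
      abs_mul, abs_pow, abs_neg, abs_one, one_pow, one_mul,
      abs_of_pos (div_pos (pow_pos hN0 _) hN0)]
    have h3 : N ^ (2 * j) * |y - x ^ 2| * |t| ≤ Real.pi / m := by
      rw [le_div_iff₀ hm, ← hyF]
      calc N ^ (2 * j) * |y - x ^ 2| * |t| * m = N ^ (2 * j) * (m * |y - x ^ 2|) * |t| := by ring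
        _ ≤ _ := mul_le_mul_of_nonneg_right (mul_le_mul_of_nonneg_left hb'.1 (by positivity)) ht.le
    calc η * (N ^ (2 * j) / N * |(dispersion j y).2 - (dispersion j (x ^ 2)).2| * |t|)
        = x * (N ^ (2 * j) * |(dispersion j y).2 - (dispersion j (x ^ 2)).2| * |t|) := by
          rw [hx]; field_simp
      _ ≤ x * (N ^ (2 * j) * (L * |y - x ^ 2|) * |t|) := by
          refine mul_le_mul_of_nonneg_left (mul_le_mul_of_nonneg_right
            (mul_le_mul_of_nonneg_left hb'.2 (by positivity)) ht.le) hx0.le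
      _ = x * L * (N ^ (2 * j) * |y - x ^ 2| * |t|) := by ring
      _ ≤ x * L * (Real.pi / m) := mul_le_mul_of_nonneg_left h3 (by positivity)
      _ ≤ e := by
          rw [le_div_iff₀ (by positivity)] at hx3
          rw [← mul_div_assoc, div_le_iff₀ hm]
          nlinarith

/-! ### Separation of solitons -/

/-- Any flow map agrees with the given Schwartz solutions, so it inherits their separation. -/
lemma not_isUniformlyContinuousOnBall {j : ℕ} {c : Coefficients} {s r R T t ε : ℝ}
    (ht : |t| < T) (hε : 0 < ε)
    (h : ∀ δ : ℝ, 0 < δ → ∃ u v : ℝ → 𝓢(ℝ, ℂ),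
      IsSchwartzSolution j c T u ∧ IsSchwartzSolution j c T v ∧
      hatNorm s r (u 0 : 𝓢'(ℝ, ℂ)) ≤ ENNReal.ofReal R ∧
      hatNorm s r (v 0 : 𝓢'(ℝ, ℂ)) ≤ ENNReal.ofReal R ∧
      hatNorm s r ((u 0 : 𝓢'(ℝ, ℂ)) - (v 0 : 𝓢'(ℝ, ℂ))) ≤ ENNReal.ofReal δ ∧
      ENNReal.ofReal ε ≤ hatNorm s r ((u t : 𝓢'(ℝ, ℂ)) - (v t : 𝓢'(ℝ, ℂ))))
    (S : HatSpace s r → ℝ → HatSpace s r) (hS : IsFlowMap j c s r R T S) :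
    ¬ IsUniformlyContinuousOnBall s r R (fun φ => S φ t) := by
  intro hu
  obtain ⟨δ, hδ, H⟩ := hu (ε / 2) (half_pos hε)
  obtain ⟨u, v, hu, hv, hu0, hv0, huv, hε'⟩ := h δ hδ
  have ht' : t ∈ Set.Ioo (-T) T := abs_lt.1 ht
  let φ : HatSpace s r := ⟨u 0, hu0.trans_lt ENNReal.ofReal_lt_top⟩
  let ψ : HatSpace s r := ⟨v 0, hv0.trans_lt ENNReal.ofReal_lt_top⟩
  have h1 := H φ ψ hu0 hv0 huv
  simp only [hS u hu φ rfl hu0 t ht', hS v hv ψ rfl hv0 t ht'] at h1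
  have h2 := (ENNReal.ofReal_le_ofReal_iff (half_pos hε).le).1 (hε'.trans h1)
  linarith

lemma norm_fourier_soliton (N : ℝ) {η : ℝ} (hη : 0 < η) (θ y ξ : ℝ) :
    ‖fourier (soliton N hη θ y) ξ‖ = ‖fourier sechSchwartz ((ξ + N) / η)‖ := by
  rw [fourier_soliton, norm_mul, mul_comm Complex.I, Complex.norm_exp_ofReal_mul_I, one_mul]

/-- A function concentrated, with rapid decay, at scale `η = c N ^ (-s q)` around `-N` has weighted
`L^q` norm bounded independently of `N`: the weight contributes `N ^ s` and the width `η ^ (1 / q) =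
c ^ (1 / q) N ^ (-s)`. -/
lemma exists_hatNorm_bound {q s : ℝ} (hq : 1 ≤ q) (hs : -(1 / q) < s) :
    ∃ (K : ℕ) (C : ℝ), 0 < C ∧ ∀ c N B : ℝ, 0 < c → c ≤ 1 → 1 ≤ N → 0 ≤ B → ∀ f : ℝ → ℂ,
      (∀ ξ, (1 + ((ξ + N) / (c * N ^ (-(s * q)))) ^ 2) ^ (K + 1) * ‖f ξ‖ ≤ B) →
      eLpNorm (fun ξ : ℝ => (((1 + ξ ^ 2) ^ (s / 2) : ℝ) : ℂ) * f ξ) (ENNReal.ofReal q) volume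
        ≤ ENNReal.ofReal (C * c ^ (1 / q) * B) := by
  have hq0 : 0 < q := by linarith
  have hσ : -1 < s * q := by
    have := mul_lt_mul_of_pos_right hs hq0
    rwa [neg_mul, one_div_mul_cancel hq0.ne'] at this
  obtain ⟨K, C, hC, hw⟩ := weight_le s (s * q) hσ (fun h => by positivity)
  refine ⟨K, (C + 1) * Real.pi ^ (1 / q), by positivity,
    fun c N B hc hc1 hN hB f hf => ?_⟩
  have hN0 : 0 < N := by linarith
  have hη0 : 0 < c * N ^ (-(s * q)) := by positivity
  have hb : ∀ ξ : ℝ, ‖(((1 + ξ ^ 2) ^ (s / 2) : ℝ) : ℂ) * f ξ‖ ≤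
      (C + 1) * N ^ s * B * (1 + ((ξ + N) / (c * N ^ (-(s * q)))) ^ 2)⁻¹ := by
    intro ξ
    have h1 := hw c N hc hc1 hN ((ξ + N) / (c * N ^ (-(s * q))))
    rw [mul_div_cancel₀ _ hη0.ne', add_sub_cancel_right] at h1
    have h2 := hf ξ
    set w := 1 + ((ξ + N) / (c * N ^ (-(s * q)))) ^ 2 with hw'
    have hw0 : 0 < w := by positivity
    rw [norm_mul, Complex.norm_real, Real.norm_of_nonneg (by positivity)]
    calc (1 + ξ ^ 2) ^ (s / 2) * ‖f ξ‖ ≤ C * N ^ s * w ^ K * ‖f ξ‖ :=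
          mul_le_mul_of_nonneg_right h1 (norm_nonneg _)
      _ = C * N ^ s * (w ^ (K + 1) * ‖f ξ‖) * w⁻¹ := by
          rw [pow_succ]
          field_simp
      _ ≤ (C + 1) * N ^ s * B * w⁻¹ := by
          refine mul_le_mul_of_nonneg_right ?_ (by positivity)
          refine mul_le_mul ?_ h2 (by positivity) (by positivity)
          exact mul_le_mul_of_nonneg_right (by linarith) (by positivity)
  refine (eLpNorm_le_of_bound hq (by positivity) hη0 hb).trans (le_of_eq ?_)
  congr 1
  have e : N ^ s * (N ^ (-(s * q))) ^ (1 / q) = 1 := by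
    rw [← Real.rpow_mul hN0.le, ← Real.rpow_add hN0]
    have : s + -(s * q) * (1 / q) = 0 := by field_simp; ring
    rw [this, Real.rpow_zero]
  rw [Real.mul_rpow (by positivity) Real.pi_pos.le, Real.mul_rpow hc.le (by positivity)]
  linear_combination ((C + 1) * B * c ^ (1 / q) * Real.pi ^ (1 / q)) * e

/-- The weight is comparable with `N ^ s` near `-N`. -/
lemma weight_ge {s N ξ : ℝ} (hN : 1 ≤ N) (hξ : |ξ + N| ≤ N / 2) :
    2 ^ (-(2 * |s|)) * N ^ s ≤ (1 + ξ ^ 2) ^ (s / 2) := by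
  have hN0 : 0 < N := by linarith
  obtain ⟨h1, h2⟩ := abs_le.1 hξ
  have hlo : N ^ 2 / 16 ≤ 1 + ξ ^ 2 := by nlinarith
  have hhi : 1 + ξ ^ 2 ≤ 16 * N ^ 2 := by nlinarith
  have e16 : ∀ a : ℝ, (16 : ℝ) ^ (a / 2) = 2 ^ (2 * a) := by
    intro a
    rw [show (16 : ℝ) = 2 ^ (4 : ℝ) by norm_num, ← Real.rpow_mul zero_le_two]
    congr 1
    ring
  have eN : (N ^ 2) ^ (s / 2) = N ^ s := by
    rw [← Real.rpow_natCast N 2, ← Real.rpow_mul hN0.le]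
    congr 1
    push_cast
    ring
  rcases le_total 0 s with hs | hs
  · refine le_trans (le_of_eq ?_) (Real.rpow_le_rpow (by positivity) hlo (by positivity))
    rw [Real.div_rpow (by positivity) (by norm_num), eN, e16, abs_of_nonneg hs,
      Real.rpow_neg zero_le_two]
    field_simp
  · refine le_trans (le_of_eq ?_) (Real.rpow_le_rpow_of_nonpos (by positivity) hhi (by linarith))
    rw [Real.mul_rpow (by norm_num) (by positivity), eN, e16, abs_of_nonpos hs]
    congr 2
    ring

lemma exp_I_mul_eq_neg_one {x : ℝ} (hx : |x| = Real.pi) :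
    Complex.exp (Complex.I * x) = -1 := by
  rcases (abs_eq Real.pi_pos.le).1 hx with h | h
  · rw [h, mul_comm, Complex.exp_pi_mul_I]
  · rw [h, Complex.ofReal_neg, mul_neg, Complex.exp_neg, mul_comm, Complex.exp_pi_mul_I]
    norm_num

/-- If the phases of two solitons differ by `π` and their centres nearly agree, then their Fourier
transforms have opposite signs near `-N`, and do not cancel. -/
lemma fourier_soliton_sub_ge {N η η' : ℝ} (hη : 0 < η) (hη' : 0 < η') {θ θ' y y' κ ξ : ℝ}
    (hθ : |θ' - θ| = Real.pi) (hle : η ≤ η') (hκ : κ ≤ 1) (hξ : |ξ + N| ≤ κ * η)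
    (hy : η * |y' - y| ≤ 1 / 8)
    (hg : ∀ x : ℝ, |x| ≤ κ → ‖fourier sechSchwartz x - fourier sechSchwartz 0‖ ≤
      ‖fourier sechSchwartz 0‖ / 8) :
    ‖fourier sechSchwartz 0‖ ≤
      ‖fourier (soliton N hη θ y) ξ - fourier (soliton N hη' θ' y') ξ‖ := by
  set g := fourier sechSchwartz with hgdef
  set α : ℝ := (ξ + N) * (y' - y) with hα
  have h1 : |(ξ + N) / η| ≤ κ := by
    rwa [abs_div, abs_of_pos hη, div_le_iff₀ hη]
  have h2 : |(ξ + N) / η'| ≤ κ := by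
    refine le_trans ?_ h1
    rw [abs_div, abs_div, abs_of_pos hη, abs_of_pos hη']
    exact div_le_div_of_nonneg_left (abs_nonneg _) hη hle
  have hα8 : |α| ≤ 1 / 8 := by
    rw [hα, abs_mul]
    refine le_trans (mul_le_mul_of_nonneg_right (hξ.trans ?_) (abs_nonneg _)) hy
    exact mul_le_of_le_one_left hη.le hκ
  have e : fourier (soliton N hη θ y) ξ - fourier (soliton N hη' θ' y') ξ =
      Complex.exp (Complex.I * ((θ + (ξ + N) * y : ℝ) : ℂ)) *
        (g ((ξ + N) / η) + Complex.exp (Complex.I * α) * g ((ξ + N) / η')) := by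
    have h3 : Complex.exp (Complex.I * ((θ' + (ξ + N) * y' : ℝ) : ℂ)) =
        Complex.exp (Complex.I * ((θ + (ξ + N) * y : ℝ) : ℂ)) *
          (Complex.exp (Complex.I * α) * Complex.exp (Complex.I * ((θ' - θ : ℝ) : ℂ))) := by
      rw [← Complex.exp_add, ← Complex.exp_add]
      congr 1
      rw [hα]
      push_cast
      ring
    rw [fourier_soliton, fourier_soliton, h3, exp_I_mul_eq_neg_one hθ]
    ring
  rw [e, norm_mul, mul_comm Complex.I, Complex.norm_exp_ofReal_mul_I, one_mul]
  have hexp : ‖Complex.exp (Complex.I * α) - 1‖ ≤ 1 / 8 :=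
    (Real.norm_exp_I_mul_ofReal_sub_one_le).trans (by simpa using hα8)
  have g1 := hg _ h1
  have g2 := hg _ h2
  have hg2 : ‖g ((ξ + N) / η')‖ ≤ 2 * ‖g 0‖ := by
    have := norm_sub_norm_le (g ((ξ + N) / η')) (g 0)
    linarith [norm_nonneg (g 0)]
  have hsplit : (2 : ℂ) * g 0 = (g ((ξ + N) / η) + Complex.exp (Complex.I * α) * g ((ξ + N) / η'))
      - (g ((ξ + N) / η) - g 0) - (g ((ξ + N) / η') - g 0)
      - (Complex.exp (Complex.I * α) - 1) * g ((ξ + N) / η') := by ring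
  have hn := congrArg norm hsplit
  rw [norm_mul, Complex.norm_ofNat] at hn
  have n1 := norm_sub_le ((g ((ξ + N) / η) + Complex.exp (Complex.I * α) * g ((ξ + N) / η'))
      - (g ((ξ + N) / η) - g 0) - (g ((ξ + N) / η') - g 0))
      ((Complex.exp (Complex.I * α) - 1) * g ((ξ + N) / η'))
  have n2 := norm_sub_le ((g ((ξ + N) / η) + Complex.exp (Complex.I * α) * g ((ξ + N) / η'))
      - (g ((ξ + N) / η) - g 0)) (g ((ξ + N) / η') - g 0)
  have n3 := norm_sub_le (g ((ξ + N) / η) + Complex.exp (Complex.I * α) * g ((ξ + N) / η'))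
      (g ((ξ + N) / η) - g 0)
  have n4 : ‖(Complex.exp (Complex.I * α) - 1) * g ((ξ + N) / η')‖ ≤ 1 / 8 * (2 * ‖g 0‖) := by
    rw [norm_mul]
    exact mul_le_mul hexp hg2 (norm_nonneg _) (by norm_num)
  linarith [norm_nonneg (g 0)]

lemma exists_small_rpow {q A B : ℝ} (hq : 0 < q) (hA : 0 ≤ A) (hB : 0 < B) :
    ∃ c : ℝ, 0 < c ∧ c ≤ 1 ∧ A * c ^ (1 / q) ≤ B := by
  refine ⟨min 1 ((B / (A + 1)) ^ q), by positivity, min_le_left _ _, ?_⟩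
  have h1 : (min 1 ((B / (A + 1)) ^ q)) ^ (1 / q) ≤ B / (A + 1) := by
    refine (Real.rpow_le_rpow (by positivity) (min_le_right _ _) (by positivity)).trans
      (le_of_eq ?_)
    rw [← Real.rpow_mul (by positivity), mul_one_div_cancel hq.ne', Real.rpow_one]
  have h2 : A * (B / (A + 1)) ≤ B := by
    rw [← mul_div_assoc, div_le_iff₀ (by positivity)]
    nlinarith
  exact (mul_le_mul_of_nonneg_left h1 hA).trans h2

/-- Soliton solutions with data in a ball, arbitrarily close initially and separated at time `t`. -/
theorem exists_separating_solutions {j : ℕ} (hj : 1 ≤ j) {r s R t : ℝ} (hq : 1 ≤ r.conjExponent)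
    (hs : -(1 / r.conjExponent) < s) (hs' : s < ((j : ℝ) - 1) / r.conjExponent) (T : ℝ)
    (hR : 0 < R) (ht : 0 < |t|) :
    ∃ ε : ℝ, 0 < ε ∧ ∀ δ : ℝ, 0 < δ → ∃ u v : ℝ → 𝓢(ℝ, ℂ),
      IsSchwartzSolution j (solitonCoefficients j) T u ∧
      IsSchwartzSolution j (solitonCoefficients j) T v ∧
      hatNorm s r (u 0 : 𝓢'(ℝ, ℂ)) ≤ ENNReal.ofReal R ∧
      hatNorm s r (v 0 : 𝓢'(ℝ, ℂ)) ≤ ENNReal.ofReal R ∧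
      hatNorm s r ((u 0 : 𝓢'(ℝ, ℂ)) - (v 0 : 𝓢'(ℝ, ℂ))) ≤ ENNReal.ofReal δ ∧
      ENNReal.ofReal ε ≤ hatNorm s r ((u t : 𝓢'(ℝ, ℂ)) - (v t : 𝓢'(ℝ, ℂ))) := by
  set q := r.conjExponent with hqdef
  have hq0 : 0 < q := by linarith
  have hσ : -1 < s * q := by
    have := mul_lt_mul_of_pos_right hs hq0
    rwa [neg_mul, one_div_mul_cancel hq0.ne'] at this
  have hσ' : s * q < (j : ℝ) - 1 := (lt_div_iff₀ hq0).1 hs'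
  obtain ⟨G, hG⟩ := exists_schwartzMap_eq_fourier sechSchwartz
  have hGf : (G : ℝ → ℂ) = fourier sechSchwartz := funext hG
  have hg0 : 0 < ‖fourier sechSchwartz 0‖ := norm_pos_iff.2 fourier_sech_zero_ne_zero
  -- on `|x| ≤ κ` the transform of `sech` is nearly constant
  obtain ⟨κ, hκ0, hκ1, hκ⟩ : ∃ κ : ℝ, 0 < κ ∧ κ ≤ 1 / 2 ∧ ∀ x : ℝ, |x| ≤ κ →
      ‖fourier sechSchwartz x - fourier sechSchwartz 0‖ ≤ ‖fourier sechSchwartz 0‖ / 8 := by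
    have hcont : Continuous (fourier sechSchwartz) := hGf ▸ G.continuous
    obtain ⟨ρ, hρ, h⟩ := Metric.continuous_iff.1 hcont 0 (‖fourier sechSchwartz 0‖ / 8)
      (by positivity)
    refine ⟨min (1 / 2) (ρ / 2), by positivity, min_le_left _ _, fun x hx => ?_⟩
    rw [← dist_eq_norm]
    refine (h x ?_).le
    rw [Real.dist_eq, sub_zero]
    linarith [hx.trans (min_le_right _ _)]
  obtain ⟨K, C, hC, hup⟩ := exists_hatNorm_bound hq hs
  obtain ⟨C₁, hC₁, hd₁⟩ := schwartz_rapid_decay G (K + 1)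
  obtain ⟨C₂, hC₂, hd₂⟩ := schwartz_dilation_sub_le G (K + 1)
  obtain ⟨c, hc, hc1, hcR⟩ := exists_small_rpow (A := C * (C₁ + C₂)) hq0 (by positivity) hR
  refine ⟨2 ^ (-(2 * |s|)) * ‖fourier sechSchwartz 0‖ * (2 * (κ * c)) ^ (1 / q), by positivity,
    fun δ hδ => ?_⟩
  obtain ⟨d, hd, hd1, hdδ⟩ : ∃ d : ℝ, 0 < d ∧ d ≤ 1 ∧ C * c ^ (1 / q) * (C₂ * d) ≤ δ := by
    refine ⟨min 1 (δ / (C * c ^ (1 / q) * C₂ + 1)), by positivity, min_le_left _ _, ?_⟩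
    have h1 := min_le_right 1 (δ / (C * c ^ (1 / q) * C₂ + 1))
    rw [le_div_iff₀ (by positivity)] at h1
    have h2 : 0 < min 1 (δ / (C * c ^ (1 / q) * C₂ + 1)) := by positivity
    nlinarith
  obtain ⟨N, η, l, hN, hη, hη0, hηN, hl1, hld, hphase, hvel⟩ :=
    exists_resonant_pair hj hσ hσ' hc hd ht (show (0 : ℝ) < 1 / 8 by norm_num)
  have hN0 : 0 < N := by linarith
  have hl0 : 0 < l := by linarith
  have hη0' : 0 < l * η := by positivity
  -- both transforms are estimated in the variable `(ξ + N) / η` of the first soliton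
  have hdiv : ∀ ξ : ℝ, (ξ + N) / (l * η) = (ξ + N) / η / l := fun ξ => by
    rw [div_div, mul_comm l]
  have hdil : ∀ ξ : ℝ, (1 + ((ξ + N) / η) ^ 2) ^ (K + 1) *
      ‖fourier sechSchwartz ((ξ + N) / η) - fourier sechSchwartz ((ξ + N) / (l * η))‖ ≤ C₂ * d := by
    intro ξ
    rw [hdiv, ← hG, ← hG]
    refine (hd₂ l hl1 (by linarith) _).trans ?_
    exact mul_le_mul_of_nonneg_left (by linarith) hC₂
  have hdec : ∀ ξ : ℝ, (1 + ((ξ + N) / η) ^ 2) ^ (K + 1) *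
      ‖fourier sechSchwartz ((ξ + N) / η)‖ ≤ C₁ := by
    intro ξ
    rw [← hG]
    exact (hd₁ _).1
  have hcR' : C * c ^ (1 / q) * (C₁ + C₂) ≤ R := by linarith
  have hw := hup c N
  rw [← hη] at hw
  refine ⟨solitonSolution j N hη0, solitonSolution j N hη0',
    isSchwartzSolution_solitonSolution j hN0.ne' hη0 T,
    isSchwartzSolution_solitonSolution j hN0.ne' hη0' T, ?_, ?_, ?_, ?_⟩
  · rw [hatNorm_coe]
    refine (hw (C₁ + C₂) hc hc1 hN (by positivity) _ fun ξ => ?_).trans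
      (ENNReal.ofReal_le_ofReal hcR')
    rw [solitonSolution, norm_fourier_soliton]
    linarith [hdec ξ]
  · rw [hatNorm_coe]
    refine (hw (C₁ + C₂) hc hc1 hN (by positivity) _ fun ξ => ?_).trans
      (ENNReal.ofReal_le_ofReal hcR')
    rw [solitonSolution, norm_fourier_soliton]
    have h1 := norm_sub_norm_le (fourier sechSchwartz ((ξ + N) / (l * η)))
      (fourier sechSchwartz ((ξ + N) / η))
    rw [norm_sub_rev] at h1
    have h2 : 0 < (1 + ((ξ + N) / η) ^ 2) ^ (K + 1) := by positivity
    have h3 := mul_le_mul_of_nonneg_left h1 h2.le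
    have h4 : C₂ * d ≤ C₂ := mul_le_of_le_one_right hC₂ hd1
    linarith [hdec ξ, hdil ξ]
  · rw [hatNorm_coe_sub]
    refine (hw (C₂ * d) hc hc1 hN (by positivity) _ fun ξ => ?_).trans
      (ENNReal.ofReal_le_ofReal hdδ)
    simp only [solitonSolution, fourier_soliton, mul_zero, add_zero]
    simpa using hdil ξ
  · rw [hatNorm_coe_sub]
    have hlow := le_eLpNorm_of_bound (q := q) (N := N) (η := κ * η)
      (a := 2 ^ (-(2 * |s|)) * N ^ s * ‖fourier sechSchwartz 0‖) hq0 (by positivity)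
      (by positivity) (f := fun ξ : ℝ => (((1 + ξ ^ 2) ^ (s / 2) : ℝ) : ℂ) *
        (fourier (solitonSolution j N hη0 t) ξ - fourier (solitonSolution j N hη0' t) ξ)) ?_
    · refine le_trans (le_of_eq ?_) hlow
      congr 1
      have e : N ^ s * (N ^ (-(s * q))) ^ (1 / q) = 1 := by
        rw [← Real.rpow_mul hN0.le, ← Real.rpow_add hN0]
        have : s + -(s * q) * (1 / q) = 0 := by field_simp; ring
        rw [this, Real.rpow_zero]
      rw [hη, show 2 * (κ * (c * N ^ (-(s * q)))) = 2 * (κ * c) * N ^ (-(s * q)) by ring,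
        Real.mul_rpow (x := 2 * (κ * c)) (by positivity) (by positivity)]
      linear_combination -(2 ^ (-(2 * |s|)) * ‖fourier sechSchwartz 0‖ *
        (2 * (κ * c)) ^ (1 / q)) * e
    · intro ξ hξ
      rw [norm_mul, Complex.norm_real, Real.norm_of_nonneg (by positivity)]
      refine mul_le_mul (weight_ge hN (hξ.trans ?_)) ?_ (norm_nonneg _) (by positivity)
      · nlinarith
      · exact fourier_soliton_sub_ge hη0 hη0' hphase (le_mul_of_one_le_left hη0.le hl1)
          (by linarith) hξ hvel hκ

end Analysis

end NLSHierarchy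

end

theorem mainTheorem3 (j : ℕ) (hj : 2 ≤ j) (r s : ℝ) (hr : 1 < r) (hr2 : r ≤ 2)
    (hs : -(1 / r.conjExponent) < s) (hs' : s < ((j : ℝ) - 1) / r.conjExponent) :
    ∃ c : NLSHierarchy.Coefficients, ∀ R T t : ℝ, 0 < R → 0 < |t| → |t| < T →
      (∀ S : NLSHierarchy.HatSpace s r → ℝ → NLSHierarchy.HatSpace s r,
        NLSHierarchy.IsFlowMap j c s r R T S →
          ¬ NLSHierarchy.IsUniformlyContinuousOnBall s r R (fun φ => S φ t)) ∧
      (∃ ε : ℝ, 0 < ε ∧ ∀ δ : ℝ, 0 < δ → ∃ u v : ℝ → 𝓢(ℝ, ℂ),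
        NLSHierarchy.IsSchwartzSolution j c T u ∧ NLSHierarchy.IsSchwartzSolution j c T v ∧
        NLSHierarchy.hatNorm s r (u 0 : 𝓢'(ℝ, ℂ)) ≤ ENNReal.ofReal R ∧
        NLSHierarchy.hatNorm s r (v 0 : 𝓢'(ℝ, ℂ)) ≤ ENNReal.ofReal R ∧
        NLSHierarchy.hatNorm s r ((u 0 : 𝓢'(ℝ, ℂ)) - (v 0 : 𝓢'(ℝ, ℂ))) ≤ ENNReal.ofReal δ ∧
        ENNReal.ofReal ε ≤ NLSHierarchy.hatNorm s r ((u t : 𝓢'(ℝ, ℂ)) - (v t : 𝓢'(ℝ, ℂ)))) := by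
  refine ⟨NLSHierarchy.solitonCoefficients j, fun R T t hR ht htT => ?_⟩
  have hq : 1 ≤ r.conjExponent := (Real.HolderConjugate.conjExponent hr).symm.lt.le
  obtain ⟨ε, hε, h⟩ :=
    NLSHierarchy.exists_separating_solutions (by omega : 1 ≤ j) hq hs hs' T hR ht
  exact ⟨NLSHierarchy.not_isUniformlyContinuousOnBall htT hε h, ε, hε, h⟩
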